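/- **Definitions.** A cubic ribbon graph $\Gamma$ (here without vertexless components) is a finite trivalent graph, loops, multiple edges and several components being allowed, together with a cyclic ordering of the three half-edges at each vertex; it embeds in a compact oriented surface so that these orderings are counterclockwise. A decoration $\gamma$ of the edges by nonnegative integers is *admissible* if at every vertex the decorations $a,b,c$ of the three incident half-edges (a loop counting twice) satisfy: $a+b+c$ is even and $|a-b|\le c\le a+b$. The Penrose evaluation $\langle\Gamma,\gamma\rangle^P$ is defined as follows. Thicken vertices to discs and edges to bands; draw $\gamma(e)$ parallel strands along each edge $e$; at each vertex with decorations $a,b,c$ join the strands without crossings, $\frac{a+b-c}{2}$ of them going from the $a$-edge to the $b$-edge, and similarly for the other two pairs. For each choice of permutations $\sigma=(\sigma_e)_e$, $\sigma_e\in\mathfrak{S}_{\gamma(e)}$, insert $\sigma_e$ in the strands of the edge $e$; this gives a collection of $N(\sigma)$ closed curves, and $$\langle\Gamma,\gamma\rangle^P=\sum_{\sigma}\Big(\prod_e \operatorname{sign}(\sigma_e)\Big)(-2)^{N(\sigma)} .$$ The unitary evaluation is $$\langle\Gamma,\gamma\rangle^U=\langle\Gamma,\gamma\rangle^P\prod_{v}\frac{1}{\left(\frac{a_v+b_v-c_v}{2}\right)!\left(\frac{a_v+c_v-b_v}{2}\right)!\left(\frac{b_v+c_v-a_v}{2}\right)!}\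 \prod_v\Theta(a_v,b_v,c_v)^{-1/2},$$ $$\Theta(a,b,c)=\frac{\left(\frac{a+b+c}{2}+1\right)!}{\left(\frac{a+b-c}{2}\right)!\left(\frac{a+c-b}{2}\right)!\left(\frac{b+c-a}{2}\right)!},$$ where $a_v,b_v,c_v$ are the decorations around the vertex $v$. For $s\ge1$, the generalized drum ${\rm Drum}_s$ is the planar cubic graph made of two concentric circles, each carrying $s$ vertices, with the $i$-th vertex of the inner circle joined to the $i$-th vertex of the outer circle by a radial edge, $1\le i\le s$ (for $s=1$ both circles are loops), with the counterclockwise cyclic orderings. A symmetric decoration is given by nonnegative integers $a_1,\ldots,a_s,b_1,\ldots,b_s$: on both circles, the arc from the $i$-th vertex to the next one (indices modulo $s$) carries $a_i$, and the $i$-th radial edge carries $b_i$. Thus the decorations around both $i$-th vertices are $a_{i-1},a_i,b_i$, with $a_0=a_s$. **Lemma.** For any $s\ge 1$ and any admissible symmetric decoration $\gamma$ of ${\rm Drum}_s$ as above, $$\left|\langle{\rm Drum}_s,\gamma\rangle^U\right|\le\frac{[\min(a_1,\ldots,a_s)+1]^2}{(a_1+1)\cdots(a_s+1)} .$$ In particular,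 $\left|\langle{\rm Drum}_s,\gamma\rangle^U\right|\le 1$ as soon as $s\ge2$. -/

import Mathlib

/-- A cubic ribbon graph without vertexless (trivial) components, with vertex set `V` and edge
set `E`; multiple edges, loops and several components are allowed.  The half-edges at a vertex `v`
are `(v, 0), (v, 1), (v, 2)`, in this counterclockwise cyclic order (addition in `Fin 3`).
Each edge `e` has two ends `(e, false)` and `(e, true)`, and `ends` glues the ends of edges
bijectively to the half-edges.  (Which end is called `false`, and which half-edge at a vertex has
number `0`, is mere bookkeeping.) -/
structure CubicRibbonGraph (V E : Type*) where
  ends : E × Bool ≃ V × Fin 3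

namespace CubicRibbonGraph

variable {V E : Type*}

/-- The decoration seen at the half-edge `(v, i)`, i.e. that of the edge attached there. -/
def decorationAt (G : CubicRibbonGraph V E) (γ : E → ℕ) (v : V) (i : Fin 3) : ℕ :=
  γ (G.ends.symm (v, i)).1

/-- Admissibility of a decoration: for the decorations `a, b, c` around each vertex, `a + b + c` is
even and `|a - b| ≤ c ≤ a + b`.  A loop is counted twice. -/
def Admissible (G : CubicRibbonGraph V E) (γ : E → ℕ) : Prop :=
  ∀ v : V,
    Even (G.decorationAt γ v 0 + G.decorationAt γ v 1 + G.decorationAt γ v 2) ∧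
    |(G.decorationAt γ v 0 : ℤ) - (G.decorationAt γ v 1 : ℤ)| ≤ (G.decorationAt γ v 2 : ℤ) ∧
    G.decorationAt γ v 2 ≤ G.decorationAt γ v 0 + G.decorationAt γ v 1

/-- The ends of strands: an edge `e` carries `γ e` parallel strands, and `⟨e, ε, j⟩` is the `j`-th
strand of `e` at the end `(e, ε)`.  At each end, the strands are numbered counterclockwise as seen
from the vertex to which this end is attached. -/
abbrev StrandEnd (γ : E → ℕ) : Type _ := (e : E) × (Bool × Fin (γ e))

/-- The planar connection of strands at the vertices.  If the half-edges `(v, i)`, `(v, i + 1)`,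
`(v, i + 2)` carry the decorations `a`, `b`, `c`, then the last `(a + b - c) / 2` strands at
`(v, i)` are joined to the first `(a + b - c) / 2` strands at `(v, i + 1)` without crossings:
the strand `a - 1 - k` to the strand `k`, for every `k < (a + b - c) / 2`. -/
def VertexJoin (G : CubicRibbonGraph V E) (γ : E → ℕ) (x y : StrandEnd γ) : Prop :=
  ∃ (v : V) (i : Fin 3),
    G.ends (x.1, x.2.1) = (v, i) ∧ G.ends (y.1, y.2.1) = (v, i + 1) ∧
    (x.2.2 : ℕ) + (y.2.2 : ℕ) + 1 = γ x.1 ∧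
    2 * (y.2.2 : ℕ) + G.decorationAt γ v (i + 2) < γ x.1 + γ y.1

/-- The connection of strands along the edges, in the state `σ`.  Along the (untwisted) band of the
edge `e`, where the Penrose bar has been replaced with the permutation `σ e`, the strand `j` at the
end `false` is joined to the strand `(σ e j).rev` at the end `true`; the reversal is there because
the two ends of a band are numbered in opposite directions across the band, so that parallel strands
(`σ e = 1`) join `j` to `j.rev`. -/
def EdgeJoin {γ : E → ℕ} (σ : (e : E) → Equiv.Perm (Fin (γ e))) (x y : StrandEnd γ) : Prop :=
  ∃ (e : E) (j : Fin (γ e)), x = ⟨e, false, j⟩ ∧ y = ⟨e, true, (σ e j).rev⟩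

/-- The number of closed curves of the state `σ`: the number of classes of strand ends for
the equivalence relation generated by all connections, at vertices and along edges. -/
noncomputable def numCurves (G : CubicRibbonGraph V E) {γ : E → ℕ}
    (σ : (e : E) → Equiv.Perm (Fin (γ e))) : ℕ :=
  Nat.card (Quot fun x y : StrandEnd γ => G.VertexJoin γ x y ∨ EdgeJoin σ x y)

/-- The Penrose evaluation: the sum over all states `σ` of `(-2)` to the number of closed curves,
times `(-1)` to the number of crossings.  Crossings occur only in the Penrose bars, and
those in the bar of `e` contribute the signature of `σ e`. -/
noncomputable def penroseEval [Fintype E] [DecidableEq E] (G : CubicRibbonGraph V E)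
    (γ : E → ℕ) : ℤ :=
  ∑ σ : (e : E) → Equiv.Perm (Fin (γ e)),
    (∏ e : E, (Equiv.Perm.sign (σ e) : ℤ)) * (-2) ^ G.numCurves σ

/-- The product `((a+b-c)/2)! ((a+c-b)/2)! ((b+c-a)/2)!` -/
def cornerFactorial (a b c : ℕ) : ℕ :=
  ((a + b - c) / 2).factorial * ((a + c - b) / 2).factorial * ((b + c - a) / 2).factorial

/-- `Θ(a, b, c) = ((a+b+c)/2 + 1)! / (((a+b-c)/2)! ((a+c-b)/2)! ((b+c-a)/2)!)` -/
noncomputable def theta (a b c : ℕ) : ℝ :=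
  (((a + b + c) / 2 + 1).factorial : ℝ) / (cornerFactorial a b c : ℝ)

/-- The standard evaluation. -/
noncomputable def standardEval [Fintype V] [Fintype E] [DecidableEq E]
    (G : CubicRibbonGraph V E) (γ : E → ℕ) : ℝ :=
  (G.penroseEval γ : ℝ) *
    ∏ v : V, (cornerFactorial (G.decorationAt γ v 0) (G.decorationAt γ v 1)
      (G.decorationAt γ v 2) : ℝ)⁻¹

/-- The unitary evaluation. -/
noncomputable def unitaryEval [Fintype V] [Fintype E] [DecidableEq E]
    (G : CubicRibbonGraph V E) (γ : E → ℕ) : ℝ :=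
  G.standardEval γ *
    ∏ v : V, (√(theta (G.decorationAt γ v 0) (G.decorationAt γ v 1)
      (G.decorationAt γ v 2)))⁻¹

end CubicRibbonGraph

/-- The generalized drum graph with `s` parallel edges between two concentric circles, drawn in
the plane.  The vertex `(i, ε)` is the `i`-th vertex (counterclockwise, `i` modulo `s`) of the inner
circle (`ε = false`) or of the outer circle (`ε = true`).  The edge `Sum.inl (i, ε)` is the arc
of the circle `ε` from `(i, ε)` to `(i + 1, ε)`, and `Sum.inr i` is the radial edge from `(i, false)`
to `(i, true)`.  Counterclockwise, one sees at an inner vertex: the outgoing arc, the incoming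
arc, the radial edge; and at an outer vertex: the outgoing arc, the radial edge, the incoming
arc. -/
def drum (s : ℕ) [NeZero s] : CubicRibbonGraph (Fin s × Bool) ((Fin s × Bool) ⊕ Fin s) where
  ends :=
    { toFun := fun p => match p with
        | (Sum.inl (i, ε), false) => ((i, ε), 0)
        | (Sum.inl (i, false), true) => ((i + 1, false), 1)
        | (Sum.inl (i, true), true) => ((i + 1, true), 2)
        | (Sum.inr i, false) => ((i, false), 2)
        | (Sum.inr i, true) => ((i, true), 1)
      invFun := fun q => match q with
        | ((i, ε), 0) => (Sum.inl (i, ε), false)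
        | ((i, false), 1) => (Sum.inl (i - 1, false), true)
        | ((i, true), 2) => (Sum.inl (i - 1, true), true)
        | ((i, false), 2) => (Sum.inr i, false)
        | ((i, true), 1) => (Sum.inr i, true)
      left_inv := by
        rintro ⟨⟨i, _ | _⟩ | i, _ | _⟩ <;> simp
      right_inv := by
        rintro ⟨⟨i, _ | _⟩, j⟩ <;> fin_cases j <;> simp }

/-- The symmetric decoration of the drum: `a i` on the `i`-th arc of both circles (so the arcs
meeting at position `i` carry `a (i - 1)` and `a i`), and `b i` on the `i`-th radial edge. -/
def drumDecoration {s : ℕ} (a b : Fin s → ℕ) : (Fin s × Bool) ⊕ Fin s → ℕ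
  | Sum.inl (i, _) => a i
  | Sum.inr i => b i

/-! The Penrose evaluation is an SL(2) spin network in disguise, and the bound is a trace estimate
for operators controlled by Schur's lemma.

A state consists of two perfect matchings of the strand ends, one at the vertices and one along the
edges. Attach to each matched pair the antisymmetric tensor and sum over all labellings of the ends
by `Bool`. Only labellings alternating along the curves survive; there are two per curve, so the sum
is `(-2)` to the number of curves up to a sign (`sum_prod_boolEps`). That sign depends on the state
only through the signatures of the permutations, so it absorbs the signs in the definition, and up
to a global sign the Penrose evaluation is a tensor contraction.

Only the number of `true` labels at each half-edge matters after the sum over permutations. This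
leaves a state sum (`abs_penroseEval_eq_stateSum`) with weights `±m! (n - m)!` on edges and, at
vertices, the coefficients of `(X₁ - X₀)^p₀ (X₂ - X₁)^p₁ (X₀ - X₂)^p₂`. That polynomial is
annihilated by the raising and lowering operators of sl(2). Hence contracting two legs of a vertex
tensor with itself gives the squared norm of the tensor, divided by the dimension `n + 1` of the
third leg, times the identity (`schur_two`, `schur_zero`).

For the drum, cut every pair of parallel arcs. The state sum becomes the trace of a cyclic product
of transfer matrices, the `i`-th one made of the two vertices at position `i` contracted along the
radial edge. Cauchy–Schwarz, with Schur's lemma used on the arc `a i` at the inner vertex and on the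
arc `a (i - 1)` at the outer one, bounds its operator norm by the norms of the two vertex tensors
divided by `√((a i + 1)(a (i - 1) + 1))` (`formBound_of_contractions`). A trace is at most the rank
times the product of the operator norms (`abs_sum_cycle_le`), and the rank is at most `(a j + 1)²`
for any `j`. The unitary normalization cancels the vertex norms; taking `a j` minimal concludes. -/

/-- The antisymmetric tensor on two indices in `Bool`. -/
def boolEps (x y : Bool) : ℤ :=
  if x = y then 0 else if x then -1 else 1

theorem boolEps_not (x : Bool) : boolEps x (!x) = if x then -1 else 1 := by
  cases x <;> rfl

theorem boolEps_eq_zero {x y : Bool} (h : y ≠ !x) : boolEps x y = 0 := by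
  cases x <;> cases y <;> simp_all [boolEps]

/-! ### Signature and number of orbits of a permutation. -/

namespace Equiv.Perm

variable {α : Type*} [Fintype α] [DecidableEq α]

/-- The number of orbits of a permutation is the number of nontrivial cycles plus the number
of fixed points. -/
theorem card_quotient_sameCycle (h : Perm α) :
    Nat.card (Quotient (SameCycle.setoid h)) =
      h.cycleFactorsFinset.card + (Fintype.card α - h.support.card) := by
  classical
  have hne : ∀ c : h.cycleFactorsFinset, ∃ x, x ∈ (c : Perm α).support := by
    rintro ⟨c, hc⟩
    exact (mem_cycleFactorsFinset_iff.mp hc).1.nonempty_support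
  choose r hr using hne
  have hr' : ∀ c, h.cycleOf (r c) = c := fun c =>
    (cycle_is_cycleOf (hr c) c.2).symm
  let φ : h.cycleFactorsFinset ⊕ {x // x ∉ h.support} → Quotient (SameCycle.setoid h) :=
    Sum.elim (fun c => Quotient.mk _ (r c)) (fun x => Quotient.mk _ x.1)
  have hrs : ∀ c, r c ∈ h.support := fun c => by
    have := hr c
    rw [← hr' c] at this
    exact (mem_support_cycleOf_iff.mp this).2
  have hφ : Function.Bijective φ := by
    constructor
    · rintro (c | x) (d | y) hxy
      · have : SameCycle h (r c) (r d) := Quotient.exact hxy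
        have h2 := this.cycleOf_eq
        rw [hr', hr'] at h2
        rw [Subtype.ext h2]
      · have : SameCycle h (r c) y := Quotient.exact hxy
        have hy : h y.1 = y.1 := by simpa using y.2
        have := this.symm.eq_of_left hy
        exact absurd (this ▸ hrs c) y.2
      · have : SameCycle h x (r d) := Quotient.exact hxy
        have hy : h x.1 = x.1 := by simpa using x.2
        have := this.eq_of_left hy
        exact absurd (this ▸ hrs d) x.2
      · have : SameCycle h x y := Quotient.exact hxy
        have hy : h x.1 = x.1 := by simpa using x.2
        have := this.eq_of_left hy
        rw [Subtype.ext this]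
    · intro q
      induction q using Quotient.inductionOn with
      | h x =>
        by_cases hx : x ∈ h.support
        · refine ⟨Sum.inl ⟨h.cycleOf x, cycleOf_mem_cycleFactorsFinset_iff.mpr hx⟩, ?_⟩
          refine Quotient.sound ?_
          have := hr ⟨h.cycleOf x, cycleOf_mem_cycleFactorsFinset_iff.mpr hx⟩
          exact (mem_support_cycleOf_iff.mp this).1.symm
        · exact ⟨Sum.inr ⟨x, hx⟩, rfl⟩
  rw [← Nat.card_congr (Equiv.ofBijective φ hφ), Nat.card_eq_fintype_card, Fintype.card_sum,
    Fintype.card_coe, Fintype.card_subtype_compl, Fintype.card_coe]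

/-- A cycle of length `l` has sign `(-1) ^ (l - 1)`, so every orbit, fixed points included,
contributes `(-1) ^ l` to the left side. -/
theorem sign_mul_neg_one_pow_card_orbits (h : Perm α) :
    (sign h : ℤ) * (-1) ^ Nat.card (Quotient (SameCycle.setoid h)) =
      (-1) ^ Fintype.card α := by
  have h1 : h.cycleType.card = h.cycleFactorsFinset.card := by
    simp [cycleType_def]
  have h2 : h.support.card ≤ Fintype.card α := Finset.card_le_univ _
  rw [card_quotient_sameCycle, sign_of_cycleType, sum_cycleType, h1]
  push_cast
  rw [← pow_add]
  obtain ⟨k, hk⟩ := Nat.exists_eq_add_of_le h2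
  have : h.support.card + h.cycleFactorsFinset.card +
    (h.cycleFactorsFinset.card + (Fintype.card α - h.support.card)) =
      Fintype.card α + 2 * h.cycleFactorsFinset.card := by omega
  rw [this, pow_add, pow_mul]
  simp

end Equiv.Perm

/-! ### Pairs of matchings: closed curves and signs. -/

section Matchings

variable {I P : Type*}

/-- Two points are joined if they are matched by `α` or by `β`. -/
def MatchingJoin (α β : I × Bool ≃ P) (x y : P) : Prop :=
  (∃ i, x = α (i, false) ∧ y = α (i, true)) ∨ (∃ i, x = β (i, false) ∧ y = β (i, true))

/-- `f` takes different values on matched points. -/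
def IsProperColoring (α : I × Bool ≃ P) (f : P → Bool) : Prop :=
  ∀ i, f (α (i, true)) = !f (α (i, false))

/-- Exchanging the two points of the pairs in `s`. -/
def pairTwist (s : I → Bool) : Equiv.Perm (I × Bool) :=
  Equiv.prodCongrRight fun i => if s i then Equiv.swap false true else 1

theorem pairTwist_apply (s : I → Bool) (i : I) (b : Bool) :
    pairTwist s (i, b) = (i, xor b (s i)) := by
  simp only [pairTwist, Equiv.prodCongrRight_apply]
  cases s i <;> cases b <;> simp

theorem sign_pairTwist [Fintype I] [DecidableEq I] (s : I → Bool) :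
    (Equiv.Perm.sign (pairTwist s) : ℤ) = ∏ i, boolEps (s i) (!s i) := by
  rw [pairTwist, Equiv.Perm.sign_prodCongrRight]
  push_cast
  refine Finset.prod_congr rfl fun i _ => ?_
  rw [boolEps_not]
  cases s i
  · simp
  · simp

theorem IsProperColoring.apply_twist {α : I × Bool ≃ P} {f : P → Bool}
    (h : IsProperColoring α f) (i : I) (b : Bool) :
    f (α (pairTwist (fun i => f (α (i, false))) (i, b))) = b := by
  rw [pairTwist_apply]
  have := h i
  cases hf : f (α (i, false)) <;> cases b <;> simp_all

/-- A twist only reverses some of the generating relations, which the generated equivalence does not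
see. -/
theorem matchingJoin_twist_iff (α β : I × Bool ≃ P) (s t : I → Bool) (x y : P) :
    Relation.EqvGen (MatchingJoin ((pairTwist s).trans α) ((pairTwist t).trans β)) x y ↔
      Relation.EqvGen (MatchingJoin α β) x y := by
  constructor
  · intro h
    induction h with
    | rel x y h =>
      rcases h with ⟨i, rfl, rfl⟩ | ⟨i, rfl, rfl⟩
      · simp only [Equiv.trans_apply, pairTwist_apply]
        cases s i
        · exact .rel _ _ (Or.inl ⟨i, rfl, rfl⟩)
        · exact .symm _ _ (.rel _ _ (Or.inl ⟨i, rfl, rfl⟩))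
      · simp only [Equiv.trans_apply, pairTwist_apply]
        cases t i
        · exact .rel _ _ (Or.inr ⟨i, rfl, rfl⟩)
        · exact .symm _ _ (.rel _ _ (Or.inr ⟨i, rfl, rfl⟩))
    | refl x => exact .refl _
    | symm _ _ _ ih => exact ih.symm
    | trans _ _ _ _ _ ih1 ih2 => exact ih1.trans _ _ _ ih2
  · intro h
    induction h with
    | rel x y h =>
      rcases h with ⟨i, rfl, rfl⟩ | ⟨i, rfl, rfl⟩
      · have h1 : Relation.EqvGen (MatchingJoin ((pairTwist s).trans α) ((pairTwist t).trans β))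
            (α (pairTwist s (i, false))) (α (pairTwist s (i, true))) :=
          .rel _ _ (Or.inl ⟨i, rfl, rfl⟩)
        rw [pairTwist_apply, pairTwist_apply] at h1
        cases hs : s i <;> rw [hs] at h1
        · exact h1
        · exact h1.symm
      · have h1 : Relation.EqvGen (MatchingJoin ((pairTwist s).trans α) ((pairTwist t).trans β))
            (β (pairTwist t (i, false))) (β (pairTwist t (i, true))) :=
          .rel _ _ (Or.inr ⟨i, rfl, rfl⟩)
        rw [pairTwist_apply, pairTwist_apply] at h1
        cases hs : t i <;> rw [hs] at h1
        · exact h1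
        · exact h1.symm
    | refl x => exact .refl _
    | symm _ _ _ ih => exact ih.symm
    | trans _ _ _ _ _ ih1 ih2 => exact ih1.trans _ _ _ ih2

theorem card_quot_twist (α β : I × Bool ≃ P) (s t : I → Bool) :
    Nat.card (Quot (MatchingJoin ((pairTwist s).trans α) ((pairTwist t).trans β))) =
      Nat.card (Quot (MatchingJoin α β)) := by
  refine Nat.card_congr ⟨Quot.lift (Quot.mk _) ?_, Quot.lift (Quot.mk _) ?_, ?_, ?_⟩
  · intro x y h
    exact Quot.eq.mpr ((matchingJoin_twist_iff α β s t x y).mp (.rel _ _ h))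
  · intro x y h
    exact Quot.eq.mpr ((matchingJoin_twist_iff α β s t x y).mpr (.rel _ _ h))
  · rintro ⟨x⟩; rfl
  · rintro ⟨x⟩; rfl

/-- The sign formula for matchings whose pairs are ordered consistently with a colouring. -/
theorem sign_mul_neg_one_pow_of_oriented [Fintype I] [DecidableEq I] (α β : I × Bool ≃ P)
    (f : P → Bool) (hα : ∀ x, f (α x) = x.2) (hβ : ∀ x, f (β x) = x.2) :
    (Equiv.Perm.sign (α.trans β.symm) : ℤ) * (-1) ^ Nat.card (Quot (MatchingJoin α β)) =
      (-1) ^ Fintype.card I := by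
  classical
  have h2 : ∀ x, (β.symm (α x)).2 = x.2 := fun x => by
    rw [← hβ, Equiv.apply_symm_apply, hα]
  have h3 : ∀ x, (α.symm (β x)).2 = x.2 := fun x => by
    rw [← hα, Equiv.apply_symm_apply, hβ]
  -- As both matchings respect the colour, passing from one to the other permutes the indices
  -- separately on each colour.
  let θ : Bool → Equiv.Perm I := fun b =>
    { toFun := fun i => (β.symm (α (i, b))).1
      invFun := fun i => (α.symm (β (i, b))).1
      left_inv := fun i => by
        have : ((β.symm (α (i, b))).1, b) = β.symm (α (i, b)) := Prod.ext rfl (h2 (i, b)).symm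
        simp [this]
      right_inv := fun i => by
        have : ((α.symm (β (i, b))).1, b) = α.symm (β (i, b)) := Prod.ext rfl (h3 (i, b)).symm
        simp [this] }
  have hθ : α.trans β.symm = Equiv.prodCongrLeft θ := by
    ext ⟨i, b⟩
    · rfl
    · simp [h2]
  have hαβ : ∀ i b, α (i, b) = β (θ b i, b) := fun i b => by
    rw [← Equiv.symm_apply_eq]
    exact Prod.ext rfl (h2 (i, b))
  have hβα : ∀ i b, β (i, b) = α ((θ b).symm i, b) := fun i b => by
    rw [hαβ]; simp
  -- Following one pair of `α` and then one pair of `β` returns to colour `false` with index moved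
  -- by `h`; closed curves are therefore the orbits of `h`.
  set h : Equiv.Perm I := (θ false)⁻¹ * θ true with hh
  have hs : (Equiv.Perm.sign (α.trans β.symm) : ℤ) = (Equiv.Perm.sign h : ℤ) := by
    rw [hθ, Equiv.Perm.sign_prodCongrLeft, hh]
    simp [mul_comm]
  have hN : Nat.card (Quot (MatchingJoin α β)) =
      Nat.card (Quotient (Equiv.Perm.SameCycle.setoid h)) := by
    refine Nat.card_congr ⟨Quot.lift (fun x => Quotient.mk _ (α.symm x).1) ?_,
      Quotient.lift (fun i => Quot.mk _ (α (i, false))) ?_, ?_, ?_⟩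
    · rintro x y (⟨i, rfl, rfl⟩ | ⟨i, rfl, rfl⟩)
      · simp
      · refine Quotient.sound ?_
        rw [hβα, hβα]
        simp only [Equiv.symm_apply_apply]
        refine Equiv.Perm.SameCycle.symm ⟨1, ?_⟩
        simp [hh, Equiv.Perm.inv_def]
    · intro i j hij
      have key : ∀ i, (Quot.mk (MatchingJoin α β) (α (h i, false))) = Quot.mk _ (α (i, false)) := by
        intro i
        have e1 : Quot.mk (MatchingJoin α β) (α (i, false)) = Quot.mk _ (α (i, true)) :=
          Quot.sound (Or.inl ⟨i, rfl, rfl⟩)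
        have e2 : Quot.mk (MatchingJoin α β) (β (θ true i, false)) =
          Quot.mk _ (β (θ true i, true)) := Quot.sound (Or.inr ⟨_, rfl, rfl⟩)
        rw [e1, hαβ i true, ← e2, hβα]
        rfl
      obtain ⟨n, rfl⟩ := (Equiv.Perm.SameCycle.exists_nat_pow_eq (hij : Equiv.Perm.SameCycle h i j))
      induction n with
      | zero => rfl
      | succ n ih =>
        rw [pow_succ', Equiv.Perm.mul_apply, key]
        exact ih ⟨n, by simp⟩
    · rintro ⟨x⟩
      obtain ⟨⟨i, b⟩, rfl⟩ := α.surjective x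
      cases b
      · simp
      · have e1 : Quot.mk (MatchingJoin α β) (α (i, false)) = Quot.mk _ (α (i, true)) :=
          Quot.sound (Or.inl ⟨i, rfl, rfl⟩)
        simpa using e1
    · intro q
      induction q using Quotient.inductionOn with
      | h i => simp
  rw [hs, hN, Equiv.Perm.sign_mul_neg_one_pow_card_orbits]

/-- The contribution of a proper colouring. -/
theorem prod_boolEps_of_isProperColoring [Fintype I] [DecidableEq I] (α β : I × Bool ≃ P)
    (f : P → Bool) (hα : IsProperColoring α f) (hβ : IsProperColoring β f) :
    (∏ i, boolEps (f (α (i, false))) (f (α (i, true)))) *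
      (∏ i, boolEps (f (β (i, false))) (f (β (i, true)))) =
    (-1) ^ Fintype.card I * (Equiv.Perm.sign (α.trans β.symm) : ℤ) *
      (-1) ^ Nat.card (Quot (MatchingJoin α β)) := by
  classical
  set s : I → Bool := fun i => f (α (i, false)) with hs
  set t : I → Bool := fun i => f (β (i, false)) with ht
  have h1 : ∏ i, boolEps (f (α (i, false))) (f (α (i, true))) =
      (Equiv.Perm.sign (pairTwist s) : ℤ) := by
    rw [sign_pairTwist]
    exact Finset.prod_congr rfl fun i _ => by rw [hα i]
  have h2 : ∏ i, boolEps (f (β (i, false))) (f (β (i, true))) =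
      (Equiv.Perm.sign (pairTwist t) : ℤ) := by
    rw [sign_pairTwist]
    exact Finset.prod_congr rfl fun i _ => by rw [hβ i]
  -- Twisting by the values of `f` orders each pair from `false` to `true`. The signs of the twists
  -- are exactly the two products of antisymmetric tensors.
  have h3 := sign_mul_neg_one_pow_of_oriented ((pairTwist s).trans α) ((pairTwist t).trans β) f
    (fun x => hα.apply_twist x.1 x.2) (fun x => hβ.apply_twist x.1 x.2)
  rw [card_quot_twist] at h3
  have h4 : ((pairTwist s).trans α).trans ((pairTwist t).trans β).symm =
      (pairTwist t)⁻¹ * (α.trans β.symm) * pairTwist s := by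
    ext x <;> rfl
  rw [h4] at h3
  simp only [map_mul, map_inv, Int.units_inv_eq_self, Units.val_mul] at h3
  rw [h1, h2, ← h3]
  have u : ∀ e : ℤˣ, (e : ℤ) * e = 1 := fun e => by
    rw [← Units.val_mul, Int.units_mul_self, Units.val_one]
  have v : ((-1 : ℤ) ^ Nat.card (Quot (MatchingJoin α β))) *
      ((-1 : ℤ) ^ Nat.card (Quot (MatchingJoin α β))) = 1 := by
    rw [← mul_pow]; simp
  linear_combination (-(Equiv.Perm.sign (pairTwist s) : ℤ) * Equiv.Perm.sign (pairTwist t)) *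
    (u (Equiv.Perm.sign (α.trans β.symm))) - (Equiv.Perm.sign (pairTwist s) : ℤ) *
    Equiv.Perm.sign (pairTwist t) * (Equiv.Perm.sign (α.trans β.symm)) *
    (Equiv.Perm.sign (α.trans β.symm)) * v

end Matchings

/-! ### Alternating colourings and Penrose's formula. -/

section Matchings

variable {I P : Type*}

/-- Two fixed-point free involutions of a countable set have a common proper 2-colouring. -/
theorem exists_coloring_of_involutions [Countable P] (τ ρ : Equiv.Perm P) (hτ : τ * τ = 1)
    (hρ : ρ * ρ = 1) (hτ' : ∀ x, τ x ≠ x) (hρ' : ∀ x, ρ x ≠ x) :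
    ∃ f : P → Bool, (∀ x, f (τ x) = !f x) ∧ ∀ x, f (ρ x) = !f x := by
  classical
  set h : Equiv.Perm P := ρ * τ with hh
  have hτi : τ⁻¹ = τ := inv_eq_of_mul_eq_one_left hτ
  have hρi : ρ⁻¹ = ρ := inv_eq_of_mul_eq_one_left hρ
  have hinv : h⁻¹ = τ * ρ := by rw [hh, mul_inv_rev, hτi, hρi]
  have hsemi : SemiconjBy τ h h⁻¹ := by
    rw [SemiconjBy, hinv, hh, mul_assoc]
  have hconj : ∀ (m : ℤ) (x : P), τ ((h ^ m) x) = (h ^ (-m)) (τ x) := by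
    intro m x
    have := (hsemi.zpow_right m).eq
    rw [inv_zpow'] at this
    exact congrArg (fun g : Equiv.Perm P => g x) this
  -- Inside one cycle of `h`, `τ` would act as a reflection: if `τ x = h ^ k x`, the midpoint gives
  -- a fixed point of `τ` for `k` even and of `ρ` for `k` odd.
  have hns : ∀ x, ¬ h.SameCycle x (τ x) := by
    rintro x ⟨k, hk⟩
    rcases Int.even_or_odd' k with ⟨m, rfl | rfl⟩
    · apply hτ' ((h ^ m) x)
      rw [hconj, ← hk, ← Equiv.Perm.mul_apply, ← zpow_add]
      congr 2; ring
    · apply hρ' (τ ((h ^ m) x))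
      have e1 : ρ (τ ((h ^ m) x)) = (h ^ (1 + m)) x := by
        rw [zpow_add, zpow_one]; rfl
      rw [e1, hconj, ← hk, ← Equiv.Perm.mul_apply, ← zpow_add]
      congr 2; ring
  -- Both involutions exchange the `h`-cycle of `x` with that of `τ x`. Numbering the cycles allows
  -- one to colour `x` according to which of the two comes first.
  obtain ⟨r, hr⟩ := exists_injective_nat (Quotient (Equiv.Perm.SameCycle.setoid h))
  let q : P → ℕ := fun x => r (Quotient.mk _ x)
  have hq : ∀ x, q (τ x) ≠ q x := fun x e => hns x (Quotient.exact (hr e)).symm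
  have hττ : ∀ x, τ (τ x) = x := fun x => congrArg (fun g : Equiv.Perm P => g x) hτ
  have hρρ : ∀ x, ρ (ρ x) = x := fun x => congrArg (fun g : Equiv.Perm P => g x) hρ
  have hq1 : ∀ x, q (ρ x) = q (τ x) := fun x => by
    refine congrArg r (Quotient.sound (Equiv.Perm.SameCycle.symm ⟨1, ?_⟩))
    simp [hh, hττ]
  have hq2 : ∀ x, q (τ (ρ x)) = q x := fun x => by
    refine congrArg r (Quotient.sound ⟨1, ?_⟩)
    simp [hh, hττ, hρρ]
  refine ⟨fun x => decide (q x < q (τ x)), fun x => ?_, fun x => ?_⟩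
  · beta_reduce
    rw [hττ]
    have := hq x
    by_cases hlt : q x < q (τ x)
    · simp [hlt, hlt.le]
    · simp only [hlt]; simp; omega
  · beta_reduce
    rw [hq1, hq2]
    have := hq x
    by_cases hlt : q x < q (τ x)
    · simp [hlt, hlt.le]
    · simp only [hlt]; simp; omega

/-- The involution exchanging the two points of each pair. -/
def matchingInvolution (α : I × Bool ≃ P) : Equiv.Perm P :=
  (α.symm.trans (pairTwist fun _ => true)).trans α

theorem matchingInvolution_apply (α : I × Bool ≃ P) (i : I) (b : Bool) :
    matchingInvolution α (α (i, b)) = α (i, !b) := by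
  simp [matchingInvolution, pairTwist_apply]

theorem exists_isProperColoring [Finite P] (α β : I × Bool ≃ P) :
    ∃ f, IsProperColoring α f ∧ IsProperColoring β f := by
  have h1 : ∀ α : I × Bool ≃ P, matchingInvolution α * matchingInvolution α = 1 := by
    intro α
    ext x
    obtain ⟨⟨i, b⟩, rfl⟩ := α.surjective x
    rw [Equiv.Perm.mul_apply, matchingInvolution_apply, matchingInvolution_apply]
    simp
  have h2 : ∀ (α : I × Bool ≃ P) (x : P), matchingInvolution α x ≠ x := by
    intro α x
    obtain ⟨⟨i, b⟩, rfl⟩ := α.surjective x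
    rw [matchingInvolution_apply]
    simp
  obtain ⟨f, hf1, hf2⟩ := exists_coloring_of_involutions _ _ (h1 α) (h1 β) (h2 α) (h2 β)
  refine ⟨f, fun i => ?_, fun i => ?_⟩
  · rw [← hf1, matchingInvolution_apply]; rfl
  · rw [← hf2, matchingInvolution_apply]; rfl

/-- The colourings form a torsor: the `xor` with a fixed one is an arbitrary function constant on
curves. -/
theorem card_isProperColoring [Finite P] (α β : I × Bool ≃ P) :
    Nat.card {f : P → Bool // IsProperColoring α f ∧ IsProperColoring β f} =
      2 ^ Nat.card (Quot (MatchingJoin α β)) := by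
  obtain ⟨f₀, h1, h2⟩ := exists_isProperColoring α β
  have e : {f : P → Bool // IsProperColoring α f ∧ IsProperColoring β f} ≃
      (Quot (MatchingJoin α β) → Bool) :=
    { toFun := fun f => Quot.lift (fun x => xor (f.1 x) (f₀ x)) (by
        rintro x y (⟨i, rfl, rfl⟩ | ⟨i, rfl, rfl⟩)
        · rw [f.2.1 i, h1 i]; simp
        · rw [f.2.2 i, h2 i]; simp)
      invFun := fun g => ⟨fun x => xor (g (Quot.mk _ x)) (f₀ x), by
        refine ⟨fun i => ?_, fun i => ?_⟩
        · have e1 : Quot.mk (MatchingJoin α β) (α (i, false)) = Quot.mk _ (α (i, true)) :=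
            Quot.sound (Or.inl ⟨i, rfl, rfl⟩)
          beta_reduce
          rw [e1, h1 i]; simp
        · have e1 : Quot.mk (MatchingJoin α β) (β (i, false)) = Quot.mk _ (β (i, true)) :=
            Quot.sound (Or.inr ⟨i, rfl, rfl⟩)
          beta_reduce
          rw [e1, h2 i]; simp⟩
      left_inv := fun f => by ext x; simp
      right_inv := fun g => by
        ext q
        induction q using Quot.ind
        simp }
  rw [Nat.card_congr e, Nat.card_fun]
  simp

/-- Penrose's formula: up to signs, `(-2)` to the number of closed curves made of two matchings is
a sum over colourings of products of antisymmetric tensors. -/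
theorem sum_prod_boolEps [Fintype I] [DecidableEq I] [Fintype P] [DecidableEq P]
    (α β : I × Bool ≃ P) :
    ∑ f : P → Bool, (∏ i, boolEps (f (α (i, false))) (f (α (i, true)))) *
      (∏ i, boolEps (f (β (i, false))) (f (β (i, true)))) =
    (-1) ^ Fintype.card I * (Equiv.Perm.sign (α.trans β.symm) : ℤ) *
      (-2) ^ Nat.card (Quot (MatchingJoin α β)) := by
  classical
  have h0 : ∀ f : P → Bool, (∏ i, boolEps (f (α (i, false))) (f (α (i, true)))) *
      (∏ i, boolEps (f (β (i, false))) (f (β (i, true)))) =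
      if IsProperColoring α f ∧ IsProperColoring β f then
        (-1) ^ Fintype.card I * (Equiv.Perm.sign (α.trans β.symm) : ℤ) *
          (-1) ^ Nat.card (Quot (MatchingJoin α β)) else 0 := by
    intro f
    split_ifs with h
    · exact prod_boolEps_of_isProperColoring α β f h.1 h.2
    · rw [not_and_or] at h
      rcases h with h | h
      · obtain ⟨i, hi⟩ := not_forall.mp h
        rw [Finset.prod_eq_zero (Finset.mem_univ i) (boolEps_eq_zero hi), zero_mul]
      · obtain ⟨i, hi⟩ := not_forall.mp h
        rw [Finset.prod_eq_zero (i := i) (s := Finset.univ) (f := fun i =>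
          boolEps (f (β (i, false))) (f (β (i, true)))) (Finset.mem_univ i) (boolEps_eq_zero hi),
          mul_zero]
  have h1 := card_isProperColoring α β
  rw [Nat.card_eq_fintype_card, Fintype.card_subtype] at h1
  -- All `2 ^ N` proper colourings contribute the same value, with `(-1) ^ N` in it; together they
  -- give `(-2) ^ N`.
  rw [Finset.sum_congr rfl fun f _ => h0 f, ← Finset.sum_filter, Finset.sum_const, h1]
  have : ((-2 : ℤ)) ^ Nat.card (Quot (MatchingJoin α β)) =
      (-1) ^ Nat.card (Quot (MatchingJoin α β)) * 2 ^ Nat.card (Quot (MatchingJoin α β)) := by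
    rw [← mul_pow]; norm_num
  rw [this, nsmul_eq_mul]
  push_cast
  ring

end Matchings

/-- Both sides are homomorphisms on a finite product of groups, so it suffices to compare them on
single factors. -/
theorem Equiv.Perm.sign_sigmaCongrRight {ι : Type*} {β : ι → Type*} [Fintype ι] [DecidableEq ι]
    [∀ i, Fintype (β i)] [∀ i, DecidableEq (β i)] (σ : ∀ i, Equiv.Perm (β i)) :
    Equiv.Perm.sign (Equiv.Perm.sigmaCongrRight σ) = ∏ i, Equiv.Perm.sign (σ i) := by
  have key : (Equiv.Perm.sign.comp (Equiv.Perm.sigmaCongrRightHom β)) =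
      ∏ i, (Equiv.Perm.sign.comp (Pi.evalMonoidHom (fun i => Equiv.Perm (β i)) i) :
        (∀ i, Equiv.Perm (β i)) →* ℤˣ) := by
    refine MonoidHom.pi_ext fun i g => ?_
    rw [MonoidHom.comp_apply, MonoidHom.finsetProd_apply, Finset.prod_eq_single i]
    · simp only [MonoidHom.comp_apply, Pi.evalMonoidHom_apply, Pi.mulSingle_eq_same]
      symm
      refine Equiv.Perm.sign_bij (fun x _ => ⟨i, x⟩) ?_ ?_ ?_
      · intro x hx hx'
        simp
      · intro x y _ _ h
        simpa using h
      · rintro ⟨j, y⟩ hy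
        by_cases hji : j = i
        · subst hji
          refine ⟨y, ?_, rfl⟩
          intro h
          apply hy
          simp [h]
        · exact absurd (by simp [Pi.mulSingle_eq_of_ne hji]) hy
    · intro j _ hj
      simp [Pi.mulSingle_eq_of_ne hj]
    · simp
  have := congrArg (fun φ : (∀ i, Equiv.Perm (β i)) →* ℤˣ => φ σ) key
  simpa [MonoidHom.finsetProd_apply] using this

/-! ### Strands of a ribbon graph as matchings; contraction of antisymmetric tensors. -/

namespace CubicRibbonGraph

variable {V E : Type*}

/-- The number of strands joining the half-edges `(v, i)` and `(v, i + 1)`. -/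
def joinCount (G : CubicRibbonGraph V E) (γ : E → ℕ) (v : V) (i : Fin 3) : ℕ :=
  (G.decorationAt γ v i + G.decorationAt γ v (i + 1) - G.decorationAt γ v (i + 2)) / 2

variable {G : CubicRibbonGraph V E} {γ : E → ℕ}

/-- Admissibility is what makes the truncated subtraction and the halving exact. -/
theorem Admissible.two_mul_joinCount (h : G.Admissible γ) (v : V) (i : Fin 3) :
    2 * G.joinCount γ v i + G.decorationAt γ v (i + 2) =
      G.decorationAt γ v i + G.decorationAt γ v (i + 1) := by
  obtain ⟨⟨k, hk⟩, h2, h3⟩ := h v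
  rw [abs_le] at h2
  fin_cases i <;> simp only [joinCount] <;> simp <;> omega

theorem Admissible.joinCount_add (h : G.Admissible γ) (v : V) (i : Fin 3) :
    G.joinCount γ v i + G.joinCount γ v (i + 1) = G.decorationAt γ v (i + 1) := by
  have h1 := h.two_mul_joinCount v i
  have h2 := h.two_mul_joinCount v (i + 1)
  have e1 : i + 1 + 2 = i := by fin_cases i <;> rfl
  have e2 : i + 1 + 1 = i + 2 := by fin_cases i <;> rfl
  rw [e1, e2] at h2
  omega

theorem Admissible.joinCount_le (h : G.Admissible γ) (v : V) (i : Fin 3) :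
    G.joinCount γ v i ≤ G.decorationAt γ v i := by
  have h1 := h.joinCount_add v (i + 2)
  have e1 : i + 2 + 1 = i := by fin_cases i <;> rfl
  rw [e1] at h1
  omega

/-- The strands at the vertices. -/
abbrev VertexStrand (G : CubicRibbonGraph V E) (γ : E → ℕ) : Type _ :=
  (v : V) × (i : Fin 3) × Fin (G.joinCount γ v i)

/-- The two ends of a strand at a vertex. -/
def vertexEnd (h : G.Admissible γ) : G.VertexStrand γ × Bool → StrandEnd γ
  | (⟨v, i, k⟩, false) => ⟨(G.ends.symm (v, i)).1, (G.ends.symm (v, i)).2,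
      ⟨G.decorationAt γ v i - 1 - k, by
        have h1 := h.joinCount_le v i
        have h2 := k.2
        change _ < G.decorationAt γ v i
        omega⟩⟩
  | (⟨v, i, k⟩, true) => ⟨(G.ends.symm (v, i + 1)).1, (G.ends.symm (v, i + 1)).2,
      ⟨k, by
        have h1 := h.joinCount_add v i
        have h2 := k.2
        change _ < G.decorationAt γ v (i + 1)
        omega⟩⟩

theorem StrandEnd.exists_eq (G : CubicRibbonGraph V E) (x : StrandEnd γ) :
    ∃ (v : V) (i : Fin 3) (j : Fin (G.decorationAt γ v i)),
      x = ⟨(G.ends.symm (v, i)).1, (G.ends.symm (v, i)).2, j⟩ := by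
  obtain ⟨e, ε, j⟩ := x
  obtain ⟨⟨v, i⟩, hvi⟩ := G.ends.symm.surjective (e, ε)
  obtain ⟨rfl, rfl⟩ : e = (G.ends.symm (v, i)).1 ∧ ε = (G.ends.symm (v, i)).2 := by
    rw [hvi]; exact ⟨rfl, rfl⟩
  exact ⟨v, i, j, rfl⟩

/-- The first strands of a half-edge go to the preceding half-edge and the remaining ones to the
next. Bijectivity then follows by counting both sides, without a direct check of injectivity. -/
theorem vertexEnd_surjective (h : G.Admissible γ) : Function.Surjective (vertexEnd h) := by
  intro x
  obtain ⟨v, i, j, rfl⟩ := StrandEnd.exists_eq G x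
  obtain ⟨i, rfl⟩ : ∃ i', i = i' + 1 := ⟨i - 1, by simp⟩
  have h1 := h.joinCount_add v i
  by_cases hj : (j : ℕ) < G.joinCount γ v i
  · exact ⟨(⟨v, i, ⟨j, hj⟩⟩, true), rfl⟩
  · refine ⟨(⟨v, i + 1, ⟨G.decorationAt γ v (i + 1) - 1 - j, by omega⟩⟩, false), ?_⟩
    have hj2 := j.2
    simp only [vertexEnd]
    congr 3
    omega

theorem card_strandEnd [Fintype E] : Fintype.card (StrandEnd γ) =
    Fintype.card ((e : E) × Fin (γ e)) * 2 := by
  simp [Finset.sum_mul, mul_comm]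

theorem card_strandEnd' [Fintype E] [Fintype V] (h : G.Admissible γ) :
    Fintype.card (StrandEnd γ) = Fintype.card (G.VertexStrand γ) * 2 := by
  classical
  have h1 : Fintype.card (StrandEnd γ) = ∑ q : E × Bool, γ q.1 := by
    rw [Fintype.sum_prod_type]
    simp
  have h2 : ∑ q : E × Bool, γ q.1 = ∑ v, ∑ i, G.decorationAt γ v i := by
    rw [← Equiv.sum_comp G.ends.symm, Fintype.sum_prod_type]
    rfl
  have h3 : ∀ v, ∑ i, G.decorationAt γ v i = (∑ i, G.joinCount γ v i) * 2 := by
    intro v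
    have a0 := h.joinCount_add v 0
    have a1 := h.joinCount_add v 1
    have a2 := h.joinCount_add v 2
    simp only [Fin.sum_univ_three]
    simp only [zero_add, show (1 : Fin 3) + 1 = 2 from rfl, show (2 : Fin 3) + 1 = 0 from rfl] at *
    omega
  rw [h1, h2, Finset.sum_congr rfl fun v _ => h3 v, ← Finset.sum_mul]
  simp [Fintype.card_sigma]

/-- The matching of the strand ends given by the strands at the vertices. -/
noncomputable def vertexEquiv [Fintype E] [Fintype V] (h : G.Admissible γ) :
    G.VertexStrand γ × Bool ≃ StrandEnd γ :=
  Equiv.ofBijective (vertexEnd h) <| by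
    classical
    rw [Fintype.bijective_iff_surjective_and_card]
    refine ⟨vertexEnd_surjective h, ?_⟩
    rw [card_strandEnd' h, Fintype.card_prod, Fintype.card_bool]

theorem vertexJoin_iff [Fintype E] [Fintype V] (h : G.Admissible γ) (x y : StrandEnd γ) :
    G.VertexJoin γ x y ↔ ∃ t, x = vertexEquiv h (t, false) ∧ y = vertexEquiv h (t, true) := by
  constructor
  · rintro ⟨v, i, hx, hy, h1, h2⟩
    obtain ⟨e, ε, j⟩ := x
    obtain ⟨e', ε', j'⟩ := y
    rw [← Equiv.eq_symm_apply] at hx hy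
    obtain ⟨rfl, rfl⟩ : e = (G.ends.symm (v, i)).1 ∧ ε = (G.ends.symm (v, i)).2 := by
      rw [← hx]; exact ⟨rfl, rfl⟩
    obtain ⟨rfl, rfl⟩ : e' = (G.ends.symm (v, i + 1)).1 ∧ ε' = (G.ends.symm (v, i + 1)).2 := by
      rw [← hy]; exact ⟨rfl, rfl⟩
    have h3 := h.two_mul_joinCount v i
    change (j : ℕ) + (j' : ℕ) + 1 = G.decorationAt γ v i at h1
    change _ < G.decorationAt γ v i + G.decorationAt γ v (i + 1) at h2
    refine ⟨⟨v, i, ⟨j', by dsimp only at h2; omega⟩⟩, ?_, rfl⟩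
    simp only [vertexEquiv, Equiv.ofBijective_apply, vertexEnd]
    congr 3
    refine Fin.ext ?_
    change (j : ℕ) = G.decorationAt γ v i - 1 - (j' : ℕ)
    omega
  · rintro ⟨⟨v, i, k⟩, rfl, rfl⟩
    refine ⟨v, i, ?_, ?_, ?_, ?_⟩
    · simp [vertexEquiv, vertexEnd]
    · simp [vertexEquiv, vertexEnd]
    · have h1 := h.joinCount_le v i
      have h2 := k.2
      change (G.decorationAt γ v i - 1 - k) + (k : ℕ) + 1 = G.decorationAt γ v i
      omega
    · have h1 := h.two_mul_joinCount v i
      have h2 := k.2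
      change 2 * (k : ℕ) + _ < G.decorationAt γ v i + G.decorationAt γ v (i + 1)
      omega

/-- The matching of the strand ends along the edges in a state. -/
def edgeEquiv (σ : (e : E) → Equiv.Perm (Fin (γ e))) :
    ((e : E) × Fin (γ e)) × Bool ≃ StrandEnd γ where
  toFun
    | (⟨e, j⟩, false) => ⟨e, false, j⟩
    | (⟨e, j⟩, true) => ⟨e, true, (σ e j).rev⟩
  invFun
    | ⟨e, false, j⟩ => (⟨e, j⟩, false)
    | ⟨e, true, j⟩ => (⟨e, (σ e).symm j.rev⟩, true)
  left_inv := by rintro ⟨⟨e, j⟩, _ | _⟩ <;> simp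
  right_inv := by rintro ⟨e, _ | _, j⟩ <;> simp

theorem edgeJoin_iff (σ : (e : E) → Equiv.Perm (Fin (γ e))) (x y : StrandEnd γ) :
    EdgeJoin σ x y ↔ ∃ t, x = edgeEquiv σ (t, false) ∧ y = edgeEquiv σ (t, true) := by
  constructor
  · rintro ⟨e, j, rfl, rfl⟩
    exact ⟨⟨e, j⟩, rfl, rfl⟩
  · rintro ⟨⟨e, j⟩, rfl, rfl⟩
    exact ⟨e, j, rfl, rfl⟩

/-- The permutations `σ e` act on the `true` ends only, hence each signature enters exactly once. -/
theorem sign_trans_edgeEquiv_symm [Fintype E] [DecidableEq E]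
    (α : ((e : E) × Fin (γ e)) × Bool ≃ StrandEnd γ) (σ : (e : E) → Equiv.Perm (Fin (γ e))) :
    (Equiv.Perm.sign (α.trans (edgeEquiv σ).symm) : ℤ) =
      Equiv.Perm.sign (α.trans (edgeEquiv 1).symm) * ∏ e, (Equiv.Perm.sign (σ e) : ℤ) := by
  set κ : Equiv.Perm (((e : E) × Fin (γ e)) × Bool) :=
    Equiv.prodCongrLeft fun b => if b then Equiv.Perm.sigmaCongrRight σ else 1 with hκ
  have h1 : edgeEquiv σ = κ.trans (edgeEquiv 1) := by
    ext1 ⟨⟨e, j⟩, b⟩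
    cases b <;> simp [hκ, edgeEquiv]
  have h2 : α.trans (edgeEquiv σ).symm = κ⁻¹ * (α.trans (edgeEquiv 1).symm) := by
    rw [h1]
    ext x <;> rfl
  have h3 : Equiv.Perm.sign κ = ∏ e, Equiv.Perm.sign (σ e) := by
    rw [hκ, Equiv.Perm.sign_prodCongrLeft]
    simp [Equiv.Perm.sign_sigmaCongrRight]
  rw [h2, map_mul, map_inv, Int.units_inv_eq_self, h3]
  push_cast
  ring

/-- The Penrose evaluation is, up to sign, a contraction of antisymmetric tensors. -/
theorem abs_penroseEval_eq [Fintype V] [Fintype E] [DecidableEq E] (h : G.Admissible γ) :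
    |G.penroseEval γ| = |∑ f : StrandEnd γ → Bool,
      (∏ t, boolEps (f (vertexEquiv h (t, false))) (f (vertexEquiv h (t, true)))) *
        ∏ e, ∑ σ : Equiv.Perm (Fin (γ e)), ∏ j,
          boolEps (f ⟨e, false, j⟩) (f ⟨e, true, (σ j).rev⟩)| := by
  classical
  have hcard : Fintype.card ((e : E) × Fin (γ e)) = Fintype.card (G.VertexStrand γ) := by
    have h1 := card_strandEnd (γ := γ)
    have h2 := card_strandEnd' h
    omega
  let e₀ := Fintype.equivOfCardEq hcard
  -- Vertex strands and edge strands are equinumerous; an arbitrary reindexing puts both matchings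
  -- over the same index type. Its effect on signs is global and disappears in absolute value.
  set α : ((e : E) × Fin (γ e)) × Bool ≃ StrandEnd γ :=
    (Equiv.prodCongr e₀ (Equiv.refl Bool)).trans (vertexEquiv h) with hα
  have hN : ∀ σ : (e : E) → Equiv.Perm (Fin (γ e)), G.numCurves σ =
      Nat.card (Quot (MatchingJoin α (edgeEquiv σ))) := by
    intro σ
    unfold numCurves
    congr 2
    funext x y
    rw [vertexJoin_iff h, edgeJoin_iff, MatchingJoin]
    congr 1
    refine propext ⟨?_, ?_⟩
    · rintro ⟨t, rfl, rfl⟩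
      exact ⟨e₀.symm t, by simp [hα], by simp [hα]⟩
    · rintro ⟨t, rfl, rfl⟩
      exact ⟨e₀ t, by simp [hα], by simp [hα]⟩
  set c : ℤ := (-1) ^ Fintype.card ((e : E) × Fin (γ e)) *
    Equiv.Perm.sign (α.trans (edgeEquiv 1).symm) with hc
  have hc1 : |c| = 1 := by
    rw [hc, abs_mul, abs_pow, abs_neg, abs_one, one_pow, one_mul]
    exact Int.isUnit_iff_abs_eq.mp (Units.isUnit _)
  have key : (∑ f : StrandEnd γ → Bool,
      (∏ t, boolEps (f (vertexEquiv h (t, false))) (f (vertexEquiv h (t, true)))) *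
        ∏ e, ∑ σ : Equiv.Perm (Fin (γ e)), ∏ j,
          boolEps (f ⟨e, false, j⟩) (f ⟨e, true, (σ j).rev⟩)) = c * G.penroseEval γ := by
    unfold penroseEval
    rw [Finset.mul_sum]
    simp_rw [Finset.prod_univ_sum, Fintype.piFinset_univ, Finset.mul_sum]
    rw [Finset.sum_comm]
    refine Finset.sum_congr rfl fun σ _ => ?_
    have h1 := sum_prod_boolEps α (edgeEquiv σ)
    rw [sign_trans_edgeEquiv_symm, ← hN] at h1
    have h2 : ∀ f : StrandEnd γ → Bool,
      (∏ t, boolEps (f (vertexEquiv h (t, false))) (f (vertexEquiv h (t, true)))) =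
        ∏ t, boolEps (f (α (t, false))) (f (α (t, true))) := by
      intro f
      rw [← Equiv.prod_comp e₀]
      rfl
    have h3 : ∀ f : StrandEnd γ → Bool,
      (∏ e, ∏ j, boolEps (f ⟨e, false, j⟩) (f ⟨e, true, (σ e j).rev⟩)) =
        ∏ t, boolEps (f (edgeEquiv σ (t, false))) (f (edgeEquiv σ (t, true))) := by
      intro f
      rw [Fintype.prod_sigma]
      rfl
    simp_rw [h2, h3]
    rw [h1, hc]
    ring
  rw [key, abs_mul, hc1, one_mul]

end CubicRibbonGraph

/-! ### Vertex tensors and edge sums in terms of label counts. -/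

open MvPolynomial in
/-- The invariant tensor at a vertex whose half-edges `i` and `i + 1` are joined by `p i` strands,
in terms of the numbers `κ i` of strands labelled `true` at the half-edges. -/
noncomputable def vertexTensor (p κ : Fin 3 → ℕ) : ℤ :=
  coeff (Finsupp.equivFunOnFinite.symm κ) (∏ i, (X (i + 1) - X i) ^ p i)

section EdgeSum

variable {α : Type*} [Fintype α] [DecidableEq α]

/-- The solutions form a coset of the stabilizer of the colouring `u`, or there is none when the
colour counts differ. -/
theorem card_perm_comp_eq (u w : α → Bool) :
    (Finset.univ.filter fun σ : Equiv.Perm α => ∀ j, w (σ j) = u j).card =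
      if (Finset.univ.filter fun j => w j = true).card = (Finset.univ.filter fun j => u j = true).card
      then (Finset.univ.filter fun j => u j = true).card.factorial *
        (Finset.univ.filter fun j => u j = false).card.factorial else 0 := by
  classical
  split_ifs with h
  · have hneg : ∀ v : α → Bool, (Finset.univ.filter fun j => v j = false).card =
        Fintype.card α - (Finset.univ.filter fun j => v j = true).card := by
      intro v
      rw [← Finset.card_univ, ← Finset.card_filter_add_card_filter_not (s := Finset.univ)
        (fun j => v j = true)]
      simp
    have h' : ∀ b, Fintype.card {j // u j = b} = Fintype.card {j // w j = b} := by
      intro b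
      rw [Fintype.card_subtype, Fintype.card_subtype]
      cases b
      · rw [hneg, hneg, h]
      · exact h.symm
    let σ₀ : Equiv.Perm α := Equiv.ofFiberEquiv (f := u) (g := w)
      fun b => Fintype.equivOfCardEq (h' b)
    have hσ₀ : ∀ j, w (σ₀ j) = u j := fun j => Equiv.ofFiberEquiv_map _ j
    have h1 := DomMulAct.stabilizer_card u
    rw [Fintype.prod_bool, Fintype.card_subtype, Fintype.card_subtype, Fintype.card_subtype] at h1
    rw [← h1]
    refine Finset.card_nbij' (fun σ => σ₀⁻¹ * σ) (fun σ => σ₀ * σ) ?_ ?_ ?_ ?_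
    · intro σ hσ
      simp only [Finset.coe_filter, Finset.mem_univ, true_and, Set.mem_ofPred_eq] at hσ ⊢
      funext j
      rw [Function.comp_apply, ← hσ₀, ← Equiv.Perm.mul_apply, mul_inv_cancel_left, hσ]
    · intro σ hσ
      simp only [Finset.coe_filter, Finset.mem_univ, true_and, Set.mem_ofPred_eq] at hσ ⊢
      intro j
      rw [Equiv.Perm.mul_apply, hσ₀]
      exact congrFun hσ j
    · intro σ _; simp
    · intro σ _; simp
  · rw [Finset.card_eq_zero, Finset.filter_eq_empty_iff]
    intro σ _ hσ
    apply h
    refine Finset.card_nbij' (fun j => σ⁻¹ j) (fun j => σ j) ?_ ?_ ?_ ?_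
    · intro j hj
      have := hσ (σ⁻¹ j)
      rw [← Equiv.Perm.mul_apply, mul_inv_cancel] at this
      have e : w j = u (σ⁻¹ j) := this
      simp only [Finset.coe_filter, Finset.mem_univ, true_and, Set.mem_ofPred_eq] at hj ⊢
      rw [← e, hj]
    · intro j hj
      simpa [hσ] using hj
    · intro j _; simp
    · intro j _; simp

/-- The sum over all permutations of the strands of an edge. -/
theorem sum_perm_prod_boolEps (u w : α → Bool) :
    ∑ σ : Equiv.Perm α, ∏ j, boolEps (u j) (w (σ j)) =
      ∑ m ∈ Finset.range (Fintype.card α + 1),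
        if (Finset.univ.filter fun j => u j = true).card = m ∧
          (Finset.univ.filter fun j => w j = true).card = Fintype.card α - m
        then (-1) ^ m * (m.factorial : ℤ) * ((Fintype.card α - m).factorial : ℤ) else 0 := by
  classical
  have h1 : ∀ σ : Equiv.Perm α, ∏ j, boolEps (u j) (w (σ j)) =
      if ∀ j, w (σ j) = !u j then
        (-1) ^ (Finset.univ.filter fun j => u j = true).card else 0 := by
    intro σ
    split_ifs with h
    · rw [← Finset.prod_const, Finset.prod_filter]
      refine Finset.prod_congr rfl fun j _ => ?_
      rw [h, boolEps_not]
    · obtain ⟨j, hj⟩ := not_forall.mp h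
      exact Finset.prod_eq_zero (Finset.mem_univ j) (boolEps_eq_zero hj)
  have hle : (Finset.univ.filter fun j => u j = true).card ≤ Fintype.card α :=
    Finset.card_le_univ _
  have hneg : (Finset.univ.filter fun j => u j = false).card =
      Fintype.card α - (Finset.univ.filter fun j => u j = true).card := by
    rw [← Finset.card_univ, ← Finset.card_filter_add_card_filter_not (s := Finset.univ)
      (fun j => u j = true)]
    simp
  have h2 := card_perm_comp_eq (fun j => !u j) w
  simp only [Bool.not_eq_true', Bool.not_eq_false', hneg] at h2
  rw [Finset.sum_congr rfl fun σ _ => h1 σ, ← Finset.sum_filter, Finset.sum_const, h2,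
    Finset.sum_eq_single (Finset.univ.filter fun j => u j = true).card]
  · simp only [true_and]
    split_ifs
    · rw [nsmul_eq_mul]; push_cast; ring
    · simp
  · intro m _ hm
    rw [if_neg fun h => hm h.1.symm]
  · intro h
    exact absurd (Finset.mem_range.mpr (Nat.lt_succ_of_le hle)) h

end EdgeSum

/-- The numbers of labels `true` at the half-edges of a vertex, when the strand ends at the first
half-edges are labelled by `g` and the opposite ends by its negation. -/
noncomputable def labelCount {p : Fin 3 → ℕ} (g : ((i : Fin 3) × Fin (p i)) → Bool) : Fin 3 →₀ ℕ :=
  ∑ t, Finsupp.single (if g t then t.1 else t.1 + 1) 1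

-- Expanding the product chooses, for each strand, one of the two variables of its factor: that is,
-- the end that bears the label `true`.
open MvPolynomial in
theorem vertexTensor_eq_sum (p κ : Fin 3 → ℕ) :
    vertexTensor p κ = ∑ g : ((i : Fin 3) × Fin (p i)) → Bool,
      if ∀ i, labelCount g i = κ i then ∏ t, boolEps (g t) (!g t) else 0 := by
  classical
  have h1 : (∏ i, (X (i + 1) - X i) ^ p i : MvPolynomial (Fin 3) ℤ) =
      ∑ g : ((i : Fin 3) × Fin (p i)) → Bool,
        monomial (labelCount g) (∏ t, boolEps (g t) (!g t)) := by
    have h2 : (∏ i, (X (i + 1) - X i) ^ p i : MvPolynomial (Fin 3) ℤ) =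
        ∏ t : (i : Fin 3) × Fin (p i), ∑ b : Bool,
          monomial (Finsupp.single (if b then t.1 else t.1 + 1) 1) (boolEps b (!b)) := by
      rw [Fintype.prod_sigma]
      refine Finset.prod_congr rfl fun i _ => ?_
      simp only [Finset.prod_const, Finset.card_univ, Fintype.card_fin]
      congr 1
      rw [Fintype.sum_bool, boolEps_not, boolEps_not]
      simp [X, sub_eq_neg_add]
    rw [h2, Finset.prod_univ_sum, Fintype.piFinset_univ]
    refine Finset.sum_congr rfl fun g _ => ?_
    rw [labelCount, monomial_sum_prod]
  rw [vertexTensor, h1, coeff_sum]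
  refine Finset.sum_congr rfl fun g _ => ?_
  rw [coeff_monomial]
  congr 1
  rw [Finsupp.ext_iff]
  rfl

/-! ### The state sum over magnetic numbers. -/

namespace CubicRibbonGraph

variable {V E : Type*} {G : CubicRibbonGraph V E} {γ : E → ℕ}

/-- The number of strands labelled `true` at an end of an edge. -/
def trueCount (f : StrandEnd γ → Bool) (q : E × Bool) : ℕ :=
  (Finset.univ.filter fun j : Fin (γ q.1) => f ⟨q.1, q.2, j⟩ = true).card

theorem trueCount_eq_sum [Fintype E] [DecidableEq E] (f : StrandEnd γ → Bool) (q : E × Bool) :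
    trueCount f q = ∑ x : StrandEnd γ, if (x.1, x.2.1) = q ∧ f x = true then 1 else 0 := by
  obtain ⟨e, b⟩ := q
  rw [trueCount, Finset.card_filter, Fintype.sum_sigma, Fintype.sum_eq_single e,
    Fintype.sum_prod_type, Fintype.sum_eq_single b]
  · simp
  · intro b' hb'; simp [hb']
  · intro e' he'; simp [he']

/-- The label counts of a labelling taking opposite values at the two ends of each strand at a
vertex. -/
theorem trueCount_ends_symm [Fintype E] [Fintype V] (h : G.Admissible γ) (f : StrandEnd γ → Bool)
    (hf : ∀ t, f (vertexEquiv h (t, true)) = !f (vertexEquiv h (t, false))) (v : V) (i : Fin 3) :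
    trueCount f (G.ends.symm (v, i)) =
      labelCount (fun t => f (vertexEquiv h (⟨v, t⟩, false))) i := by
  classical
  rw [trueCount_eq_sum, ← Equiv.sum_comp (vertexEquiv h), Fintype.sum_prod_type,
    Fintype.sum_sigma, Fintype.sum_eq_single v]
  · rw [labelCount, Finsupp.finsetSum_apply]
    refine Finset.sum_congr rfl fun t _ => ?_
    obtain ⟨i', k⟩ := t
    rw [Fintype.sum_bool, hf]
    have e1 : ((vertexEquiv h (⟨v, i', k⟩, true)).1, (vertexEquiv h (⟨v, i', k⟩, true)).2.1) =
      G.ends.symm (v, i' + 1) := rfl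
    have e2 : ((vertexEquiv h (⟨v, i', k⟩, false)).1, (vertexEquiv h (⟨v, i', k⟩, false)).2.1) =
      G.ends.symm (v, i') := rfl
    rw [e1, e2]
    cases f (vertexEquiv h (⟨v, i', k⟩, false)) <;> simp [Finsupp.single_apply]
  · intro v' hv'
    refine Finset.sum_eq_zero fun t _ => ?_
    obtain ⟨i', k⟩ := t
    have e1 : ((vertexEquiv h (⟨v', i', k⟩, true)).1, (vertexEquiv h (⟨v', i', k⟩, true)).2.1) =
      G.ends.symm (v', i' + 1) := rfl
    have e2 : ((vertexEquiv h (⟨v', i', k⟩, false)).1, (vertexEquiv h (⟨v', i', k⟩, false)).2.1) =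
      G.ends.symm (v', i') := rfl
    rw [Fintype.sum_bool, e1, e2]
    simp [hv']

/-- A labelling contributes only if it is opposite at the two ends of each vertex strand. It is then
determined by independent choices at the vertices, so the sum factors. -/
theorem sum_boolEps_of_trueCount [Fintype E] [Fintype V] [DecidableEq E] (h : G.Admissible γ)
    (κ : E × Bool → ℕ) :
    (∑ f : StrandEnd γ → Bool, if ∀ q, trueCount f q = κ q then
      (∏ t, boolEps (f (vertexEquiv h (t, false))) (f (vertexEquiv h (t, true)))) else 0) =
    ∏ v, vertexTensor (G.joinCount γ v) (fun i => κ (G.ends.symm (v, i))) := by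
  classical
  simp_rw [vertexTensor_eq_sum]
  rw [Finset.prod_univ_sum, Fintype.piFinset_univ]
  let Φ : ((v : V) → ((i : Fin 3) × Fin (G.joinCount γ v i)) → Bool) →
      G.VertexStrand γ × Bool → Bool := fun g y => xor (g y.1.1 y.1.2) y.2
  let ψ : ((v : V) → ((i : Fin 3) × Fin (G.joinCount γ v i)) → Bool) → StrandEnd γ → Bool :=
    fun g x => Φ g ((vertexEquiv h).symm x)
  have hψ0 : ∀ g v t, ψ g (vertexEquiv h (⟨v, t⟩, false)) = g v t := by
    intro g v t
    refine (congrArg (Φ g) (Equiv.symm_apply_apply _ _)).trans ?_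
    simp [Φ]
  have hψ1 : ∀ g v t, ψ g (vertexEquiv h (⟨v, t⟩, true)) = !g v t := by
    intro g v t
    refine (congrArg (Φ g) (Equiv.symm_apply_apply _ _)).trans ?_
    simp [Φ]
  have hψ : Function.Injective ψ := by
    intro g g' hg
    funext v t
    rw [← hψ0 g, hg, hψ0]
  symm
  refine Finset.sum_of_injOn ψ hψ.injOn (by simp) ?_ ?_
  · intro f _ hf
    rw [ite_eq_right_iff]
    intro _
    by_contra hne
    apply hf
    have hne := Finset.prod_ne_zero_iff.mp hne
    let g : (v : V) → ((i : Fin 3) × Fin (G.joinCount γ v i)) → Bool :=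
      fun v t => f (vertexEquiv h (⟨v, t⟩, false))
    refine ⟨g, by simp, ?_⟩
    funext x
    obtain ⟨⟨⟨v, t⟩, b⟩, rfl⟩ := (vertexEquiv h).surjective x
    cases b
    · exact hψ0 g v t
    · refine (hψ1 g v t).trans ?_
      by_contra hx
      exact hne ⟨v, t⟩ (Finset.mem_univ _) (boolEps_eq_zero (Ne.symm hx))
  · intro g _
    have h1 : ∀ v i, trueCount (ψ g) (G.ends.symm (v, i)) = labelCount (g v) i := by
      intro v i
      rw [trueCount_ends_symm h]
      · simp_rw [hψ0]
      · rintro ⟨v, t⟩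
        rw [hψ0, hψ1]
    rw [Finset.prod_ite_zero]
    have h2 : (∀ v ∈ Finset.univ, ∀ i, labelCount (g v) i = κ (G.ends.symm (v, i))) ↔
        ∀ q, trueCount (ψ g) q = κ q := by
      simp_rw [← h1]
      rw [G.ends.symm.surjective.forall]
      simp
    by_cases hq : ∀ q, trueCount (ψ g) q = κ q
    · rw [if_pos (h2.mpr hq), if_pos hq, Fintype.prod_sigma]
      simp_rw [hψ0, hψ1]
    · rw [if_neg fun hq' => hq (h2.mp hq'), if_neg hq]

/-- The numbers of labels `true` at the ends of the edges, when there are `m e` at the first end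
of the edge `e` and opposite labels at the second end. -/
def magneticNumber (γ m : E → ℕ) (q : E × Bool) : ℕ :=
  if q.2 then γ q.1 - m q.1 else m q.1

/-- The Penrose evaluation as a state sum over magnetic numbers on the edges. -/
theorem abs_penroseEval_eq_stateSum [Fintype V] [Fintype E] [DecidableEq E]
    (h : G.Admissible γ) :
    |G.penroseEval γ| = |∑ m ∈ Fintype.piFinset fun e => Finset.range (γ e + 1),
      (∏ e, (-1) ^ m e * ((m e).factorial : ℤ) * ((γ e - m e).factorial : ℤ)) *
        ∏ v, vertexTensor (G.joinCount γ v)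
          (fun i => magneticNumber γ m (G.ends.symm (v, i)))| := by
  classical
  rw [abs_penroseEval_eq h]
  congr 1
  have h1 : ∀ (f : StrandEnd γ → Bool) (e : E), (∑ σ : Equiv.Perm (Fin (γ e)), ∏ j,
      boolEps (f ⟨e, false, j⟩) (f ⟨e, true, (σ j).rev⟩)) =
      ∑ m ∈ Finset.range (γ e + 1), if trueCount f (e, false) = m ∧
        trueCount f (e, true) = γ e - m then
          (-1) ^ m * (m.factorial : ℤ) * ((γ e - m).factorial : ℤ) else 0 := by
    intro f e
    rw [sum_perm_prod_boolEps (fun j => f ⟨e, false, j⟩) (fun j => f ⟨e, true, j.rev⟩)]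
    have : (Finset.univ.filter fun j : Fin (γ e) => f ⟨e, true, j.rev⟩ = true).card =
        trueCount f (e, true) := by
      rw [trueCount]
      refine Finset.card_nbij' Fin.rev Fin.rev ?_ ?_ ?_ ?_ <;> intro j <;> simp
    rw [this, Fintype.card_fin]
    rfl
  simp_rw [h1, Finset.prod_univ_sum, Finset.mul_sum]
  rw [Finset.sum_comm]
  refine Finset.sum_congr rfl fun m _ => ?_
  rw [← sum_boolEps_of_trueCount h, Finset.mul_sum]
  refine Finset.sum_congr rfl fun f _ => ?_
  rw [Finset.prod_ite_zero]
  have h2 : (∀ e ∈ Finset.univ, trueCount f (e, false) = m e ∧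
      trueCount f (e, true) = γ e - m e) ↔ ∀ q, trueCount f q = magneticNumber γ m q := by
    constructor
    · rintro h ⟨e, _ | _⟩
      · exact (h e (Finset.mem_univ e)).1
      · exact (h e (Finset.mem_univ e)).2
    · exact fun h e _ => ⟨h (e, false), h (e, true)⟩
  simp only [h2]
  split_ifs
  · ring
  · simp

end CubicRibbonGraph

/-! ### Symmetry and sl(2)-invariance of the vertex tensor. -/

/-- The vertex tensor in curried form. -/
noncomputable def triTensor (p₀ p₁ p₂ k₀ k₁ k₂ : ℕ) : ℤ :=
  vertexTensor ![p₀, p₁, p₂] ![k₀, k₁, k₂]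

section TriTensor

open MvPolynomial

/-- The generating polynomial of the vertex tensor. -/
noncomputable def triPoly (p₀ p₁ p₂ : ℕ) : MvPolynomial (Fin 3) ℤ :=
  (X 1 - X 0) ^ p₀ * (X 2 - X 1) ^ p₁ * (X 0 - X 2) ^ p₂

/-- A monomial in three variables. -/
noncomputable def triExp (k₀ k₁ k₂ : ℕ) : Fin 3 →₀ ℕ :=
  Finsupp.equivFunOnFinite.symm ![k₀, k₁, k₂]

theorem triExp_zero (k₀ k₁ k₂ : ℕ) : triExp k₀ k₁ k₂ 0 = k₀ := rfl
theorem triExp_one (k₀ k₁ k₂ : ℕ) : triExp k₀ k₁ k₂ 1 = k₁ := rfl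
theorem triExp_two (k₀ k₁ k₂ : ℕ) : triExp k₀ k₁ k₂ 2 = k₂ := rfl

theorem triExp_add_single_zero (k₀ k₁ k₂ : ℕ) :
    triExp k₀ k₁ k₂ + Finsupp.single 0 1 = triExp (k₀ + 1) k₁ k₂ := by
  ext i; fin_cases i <;> simp [triExp]

theorem triExp_add_single_one (k₀ k₁ k₂ : ℕ) :
    triExp k₀ k₁ k₂ + Finsupp.single 1 1 = triExp k₀ (k₁ + 1) k₂ := by
  ext i; fin_cases i <;> simp [triExp]

theorem triExp_add_single_two (k₀ k₁ k₂ : ℕ) :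
    triExp k₀ k₁ k₂ + Finsupp.single 2 1 = triExp k₀ k₁ (k₂ + 1) := by
  ext i; fin_cases i <;> simp [triExp]

theorem triTensor_eq_coeff (p₀ p₁ p₂ k₀ k₁ k₂ : ℕ) :
    triTensor p₀ p₁ p₂ k₀ k₁ k₂ = coeff (triExp k₀ k₁ k₂) (triPoly p₀ p₁ p₂) := by
  rw [triTensor, vertexTensor, Fin.prod_univ_three]
  rfl

theorem vertexTensor_eq_triTensor (p κ : Fin 3 → ℕ) :
    vertexTensor p κ = triTensor (p 0) (p 1) (p 2) (κ 0) (κ 1) (κ 2) := by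
  rw [triTensor]
  congr 1 <;> (ext i; fin_cases i <;> rfl)

theorem triTensor_rotate (p₀ p₁ p₂ k₀ k₁ k₂ : ℕ) :
    triTensor p₁ p₂ p₀ k₁ k₂ k₀ = triTensor p₀ p₁ p₂ k₀ k₁ k₂ := by
  rw [triTensor_eq_coeff, triTensor_eq_coeff]
  have h1 : triPoly p₀ p₁ p₂ = rename (fun i : Fin 3 => i + 1) (triPoly p₁ p₂ p₀) := by
    simp only [triPoly, map_mul, map_pow, map_sub, rename_X]
    simp only [zero_add, show (1 : Fin 3) + 1 = 2 from rfl, show (2 : Fin 3) + 1 = 0 from rfl]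
    ring
  have h2 : triExp k₀ k₁ k₂ = (triExp k₁ k₂ k₀).mapDomain (fun i : Fin 3 => i + 1) := by
    ext i
    obtain ⟨i, rfl⟩ : ∃ j, i = j + 1 := ⟨i - 1, by simp⟩
    rw [Finsupp.mapDomain_apply (add_left_injective 1)]
    fin_cases i <;> rfl
  rw [h1, h2, coeff_rename_mapDomain _ (add_left_injective 1)]

/-- The polynomial depends only on differences of the variables, hence is invariant under
simultaneous translation: this is the first sl(2) relation. -/
theorem triPoly_pderiv_sum (p₀ p₁ p₂ : ℕ) :
    pderiv 0 (triPoly p₀ p₁ p₂) + pderiv 1 (triPoly p₀ p₁ p₂) + pderiv 2 (triPoly p₀ p₁ p₂) = 0 := by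
  simp [triPoly, Derivation.leibniz, Derivation.leibniz_pow, pderiv_X]
  ring

theorem triTensor_raise (p₀ p₁ p₂ k₀ k₁ k₂ : ℕ) :
    (k₀ + 1 : ℤ) * triTensor p₀ p₁ p₂ (k₀ + 1) k₁ k₂ +
      (k₁ + 1) * triTensor p₀ p₁ p₂ k₀ (k₁ + 1) k₂ +
      (k₂ + 1) * triTensor p₀ p₁ p₂ k₀ k₁ (k₂ + 1) = 0 := by
  have h := congrArg (coeff (triExp k₀ k₁ k₂)) (triPoly_pderiv_sum p₀ p₁ p₂)
  rw [coeff_add, coeff_add, coeff_pderiv, coeff_pderiv, coeff_pderiv, triExp_add_single_zero,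
    triExp_add_single_one, triExp_add_single_two, triExp_zero, triExp_one, triExp_two,
    coeff_zero] at h
  simp only [triTensor_eq_coeff]
  linear_combination h

/-- The second sl(2) relation, for the operators `X i * (n i - X i ∂ i)` with `n i` the degree in `X
i`. By the Leibniz rule it reduces to one identity per factor. -/
theorem triPoly_lower (p₀ p₁ p₂ : ℕ) :
    X 0 * ((p₀ + p₂ : MvPolynomial (Fin 3) ℤ) * triPoly p₀ p₁ p₂ -
        X 0 * pderiv 0 (triPoly p₀ p₁ p₂)) +
      X 1 * ((p₀ + p₁ : MvPolynomial (Fin 3) ℤ) * triPoly p₀ p₁ p₂ -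
        X 1 * pderiv 1 (triPoly p₀ p₁ p₂)) +
      X 2 * ((p₁ + p₂ : MvPolynomial (Fin 3) ℤ) * triPoly p₀ p₁ p₂ -
        X 2 * pderiv 2 (triPoly p₀ p₁ p₂)) = 0 := by
  have h : ∀ (p : ℕ) (y : MvPolynomial (Fin 3) ℤ), (p : MvPolynomial (Fin 3) ℤ) * y ^ (p - 1) * y =
      p * y ^ p := by
    intro p y
    cases p with
    | zero => simp
    | succ p => rw [Nat.add_sub_cancel, pow_succ]; ring
  have h0 := h p₀ (X 1 - X 0)
  have h1 := h p₁ (X 2 - X 1)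
  have h2 := h p₂ (X 0 - X 2)
  simp [triPoly, Derivation.leibniz, Derivation.leibniz_pow, pderiv_X]
  linear_combination (-(X 1 + X 0) * (X 2 - X 1) ^ p₁ * (X 0 - X 2) ^ p₂) * h0 -
    ((X 1 + X 2) * (X 1 - X 0) ^ p₀ * (X 0 - X 2) ^ p₂) * h1 -
    ((X 2 + X 0) * (X 1 - X 0) ^ p₀ * (X 2 - X 1) ^ p₁) * h2

/-- The coefficient of the lowering operator. -/
def lowerTerm (n : ℕ) (ψ : ℕ → ℤ) (k : ℕ) : ℤ :=
  if k = 0 then 0 else (n - k + 1) * ψ (k - 1)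

theorem coeff_X_mul_pderiv (F : MvPolynomial (Fin 3) ℤ) (i : Fin 3) (m : Fin 3 →₀ ℕ) :
    coeff m (X i * pderiv i F) = m i * coeff m F := by
  classical
  rw [coeff_X_mul']
  split_ifs with h
  · have h1 : m - Finsupp.single i 1 + Finsupp.single i 1 = m := by
      refine tsub_add_cancel_of_le ?_
      rw [Finsupp.single_le_iff]
      exact Nat.one_le_iff_ne_zero.mpr (Finsupp.mem_support_iff.mp h)
    have h2 : (((m - Finsupp.single i 1 : Fin 3 →₀ ℕ) i : ℕ) : ℤ) + 1 = m i := by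
      have := DFunLike.congr_fun h1 i
      simp only [Finsupp.coe_add, Pi.add_apply, Finsupp.single_eq_same] at this
      exact_mod_cast this
    rw [coeff_pderiv, h1, h2, mul_comm]
  · rw [Finsupp.notMem_support_iff.mp h]; simp

theorem coeff_lower (F : MvPolynomial (Fin 3) ℤ) (i : Fin 3) (m : Fin 3 →₀ ℕ) (n : ℕ) :
    coeff (m + Finsupp.single i 1) (X i * ((n : MvPolynomial (Fin 3) ℤ) * F - X i * pderiv i F)) =
      (n - m i) * coeff m F := by
  rw [add_comm, coeff_X_mul, coeff_sub, coeff_X_mul_pderiv, ← map_natCast (C (σ := Fin 3) (R := ℤ)),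
    coeff_C_mul]
  ring

theorem coeff_lower_of_eq_zero (F : MvPolynomial (Fin 3) ℤ) (i : Fin 3) (m : Fin 3 →₀ ℕ)
    (h : m i = 0) : coeff m (X i * F) = 0 := by
  classical
  rw [coeff_X_mul', if_neg]
  simpa using h

theorem triTensor_lower (p₀ p₁ p₂ k₀ k₁ k₂ : ℕ) :
    lowerTerm (p₀ + p₂) (fun k => triTensor p₀ p₁ p₂ k k₁ (k₂ + 1)) k₀ +
      lowerTerm (p₀ + p₁) (fun k => triTensor p₀ p₁ p₂ k₀ k (k₂ + 1)) k₁ +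
      ((p₁ + p₂ : ℕ) - k₂ : ℤ) * triTensor p₀ p₁ p₂ k₀ k₁ k₂ = 0 := by
  have h := congrArg (coeff (triExp k₀ k₁ (k₂ + 1))) (triPoly_lower p₀ p₁ p₂)
  rw [coeff_add, coeff_add, coeff_zero] at h
  simp only [triTensor_eq_coeff]
  simp only [← Nat.cast_add] at h
  have e2 := coeff_lower (triPoly p₀ p₁ p₂) 2 (triExp k₀ k₁ k₂) (p₁ + p₂)
  rw [triExp_add_single_two, triExp_two] at e2
  rw [e2] at h
  rw [← h]
  congr 2
  · cases k₀ with
    | zero =>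
      rw [coeff_lower_of_eq_zero _ _ _ (triExp_zero _ _ _), lowerTerm, if_pos rfl]
    | succ k₀ =>
      have e0 := coeff_lower (triPoly p₀ p₁ p₂) 0 (triExp k₀ k₁ (k₂ + 1)) (p₀ + p₂)
      rw [triExp_add_single_zero, triExp_zero] at e0
      rw [e0, lowerTerm, if_neg (Nat.succ_ne_zero _), Nat.add_sub_cancel]
      push_cast; ring
  · cases k₁ with
    | zero =>
      rw [coeff_lower_of_eq_zero _ _ _ (triExp_one _ _ _), lowerTerm, if_pos rfl]
    | succ k₁ =>
      have e0 := coeff_lower (triPoly p₀ p₁ p₂) 1 (triExp k₀ k₁ (k₂ + 1)) (p₀ + p₁)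
      rw [triExp_add_single_one, triExp_one] at e0
      rw [e0, lowerTerm, if_neg (Nat.succ_ne_zero _), Nat.add_sub_cancel]
      push_cast; ring

theorem exists_labelCount_of_vertexTensor_ne_zero {p κ : Fin 3 → ℕ} (h : vertexTensor p κ ≠ 0) :
    ∃ g : ((i : Fin 3) × Fin (p i)) → Bool, ∀ i, labelCount g i = κ i := by
  rw [vertexTensor_eq_sum] at h
  obtain ⟨g, _, hg⟩ := Finset.exists_ne_zero_of_sum_ne_zero h
  exact ⟨g, by_contra fun h' => hg (if_neg h')⟩

theorem sum_labelCount {p : Fin 3 → ℕ} (g : ((i : Fin 3) × Fin (p i)) → Bool) :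
    ∑ i, labelCount g i = ∑ i, p i := by
  simp only [labelCount, Finsupp.finsetSum_apply]
  rw [Finset.sum_comm]
  simp [Finsupp.single_apply]

/-- The strands touching half-edge `i` are those of index `i` and of index `i - 1`, written `i + 2`
in `Fin 3`. -/
theorem labelCount_le {p : Fin 3 → ℕ} (g : ((i : Fin 3) × Fin (p i)) → Bool) (i : Fin 3) :
    labelCount g i ≤ p i + p (i + 2) := by
  have h1 : labelCount g i ≤ ∑ t : (i : Fin 3) × Fin (p i),
      ((if t.1 = i then 1 else 0) + (if t.1 = i + 2 then 1 else 0)) := by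
    simp only [labelCount, Finsupp.finsetSum_apply]
    refine Finset.sum_le_sum fun t _ => ?_
    obtain ⟨j, k⟩ := t
    cases g ⟨j, k⟩ <;> fin_cases i <;> fin_cases j <;> simp
  refine h1.trans (le_of_eq ?_)
  rw [Finset.sum_add_distrib, Fintype.sum_sigma, Fintype.sum_sigma]
  simp [apply_ite Finset.card]

/-- Homogeneity of the generating polynomial: each strand bears exactly one label `true`. -/
theorem triTensor_sum_eq {p₀ p₁ p₂ k₀ k₁ k₂ : ℕ} (h : triTensor p₀ p₁ p₂ k₀ k₁ k₂ ≠ 0) :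
    k₀ + k₁ + k₂ = p₀ + p₁ + p₂ := by
  obtain ⟨g, hg⟩ := exists_labelCount_of_vertexTensor_ne_zero h
  have := sum_labelCount g
  simpa [hg, Fin.sum_univ_three] using this

theorem triTensor_eq_zero₀ {p₀ p₁ p₂ k₀ k₁ k₂ : ℕ} (h : p₀ + p₂ < k₀) :
    triTensor p₀ p₁ p₂ k₀ k₁ k₂ = 0 := by
  by_contra h'
  obtain ⟨g, hg⟩ := exists_labelCount_of_vertexTensor_ne_zero h'
  have := labelCount_le g 0
  rw [hg] at this
  exact absurd this (not_le.mpr h)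

theorem triTensor_eq_zero₁ {p₀ p₁ p₂ k₀ k₁ k₂ : ℕ} (h : p₀ + p₁ < k₁) :
    triTensor p₀ p₁ p₂ k₀ k₁ k₂ = 0 := by
  rw [← triTensor_rotate]
  exact triTensor_eq_zero₀ (by omega)

end TriTensor

/-! ### Schur's lemma for the vertex tensor. -/

/-- The squared norm of the state with `k` labels `true` on `n` strands. -/
def binWeight (n k : ℕ) : ℤ :=
  (k.factorial : ℤ) * ((n - k).factorial : ℤ)

/-- The squared norm of the vertex tensor. -/
def vertexNorm (p₀ p₁ p₂ : ℕ) : ℕ :=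
  p₀.factorial * p₁.factorial * p₂.factorial * (p₀ + p₁ + p₂ + 1).factorial

theorem binWeight_pos (n k : ℕ) : 0 < binWeight n k := by
  unfold binWeight; positivity

theorem binWeight_sub {n k : ℕ} (h : k ≤ n) : binWeight n (n - k) = binWeight n k := by
  rw [binWeight, binWeight, Nat.sub_sub_self h, mul_comm]

/-- Raising and lowering are adjoint for the weight `k! (n - k)!`; the hypothesis removes the
boundary term. -/
theorem sum_binWeight_shift (n : ℕ) (φ ψ : ℕ → ℤ) (hφ : φ (n + 1) = 0) :
    ∑ k ∈ Finset.range (n + 1), binWeight n k * ((k + 1) * φ (k + 1)) * ψ k =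
      ∑ k ∈ Finset.range (n + 1), binWeight n k * lowerTerm n ψ k * φ k := by
  rw [Finset.sum_range_succ, hφ, Finset.sum_range_succ']
  simp only [lowerTerm, if_true, mul_zero, zero_mul, add_zero]
  refine Finset.sum_congr rfl fun k hk => ?_
  have hk' : k < n := Finset.mem_range.mp hk
  obtain ⟨d, rfl⟩ := Nat.exists_eq_add_of_lt hk'
  rw [if_neg (Nat.succ_ne_zero k), Nat.add_sub_cancel, binWeight, binWeight,
    show k + d + 1 - k = d + 1 by omega, show k + d + 1 - (k + 1) = d by omega,
    Nat.factorial_succ, Nat.factorial_succ]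
  push_cast
  ring

/-- The partial contraction of the vertex tensor with itself. -/
noncomputable def contraction (p₀ p₁ p₂ c : ℕ) : ℤ :=
  ∑ k₀ ∈ Finset.range (p₀ + p₂ + 1), ∑ k₁ ∈ Finset.range (p₀ + p₁ + 1),
    binWeight (p₀ + p₂) k₀ * binWeight (p₀ + p₁) k₁ * triTensor p₀ p₁ p₂ k₀ k₁ c ^ 2

/-- The raising relation moves the operator on the third leg to the other two legs at level `c`, the
lowering relation does so at level `c + 1`, and adjointness identifies the two results. -/
theorem contraction_succ (p₀ p₁ p₂ c : ℕ) :
    (c + 1 : ℤ) * contraction p₀ p₁ p₂ (c + 1) =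
      ((p₁ + p₂ : ℕ) - c : ℤ) * contraction p₀ p₁ p₂ c := by
  set f : ℕ → ℕ → ℤ := fun k₀ k₁ => triTensor p₀ p₁ p₂ k₀ k₁ c with hf
  set g : ℕ → ℕ → ℤ := fun k₀ k₁ => triTensor p₀ p₁ p₂ k₀ k₁ (c + 1) with hg
  set W₀ := binWeight (p₀ + p₂) with hW₀
  set W₁ := binWeight (p₀ + p₁) with hW₁
  have hL : (c + 1 : ℤ) * contraction p₀ p₁ p₂ (c + 1) =
      -(∑ k₁ ∈ Finset.range (p₀ + p₁ + 1), W₁ k₁ * ∑ k₀ ∈ Finset.range (p₀ + p₂ + 1),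
          W₀ k₀ * ((k₀ + 1) * f (k₀ + 1) k₁) * g k₀ k₁) -
        (∑ k₀ ∈ Finset.range (p₀ + p₂ + 1), W₀ k₀ * ∑ k₁ ∈ Finset.range (p₀ + p₁ + 1),
          W₁ k₁ * ((k₁ + 1) * f k₀ (k₁ + 1)) * g k₀ k₁) := by
    simp only [contraction, Finset.mul_sum]
    rw [Finset.sum_comm (s := Finset.range (p₀ + p₁ + 1))]
    simp only [← Finset.sum_neg_distrib, ← Finset.sum_sub_distrib]
    refine Finset.sum_congr rfl fun k₀ _ => Finset.sum_congr rfl fun k₁ _ => ?_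
    have h := triTensor_raise p₀ p₁ p₂ k₀ k₁ c
    change (k₀ + 1 : ℤ) * f (k₀ + 1) k₁ + (k₁ + 1) * f k₀ (k₁ + 1) + (c + 1) * g k₀ k₁ = 0 at h
    change (c + 1 : ℤ) * (W₀ k₀ * W₁ k₁ * g k₀ k₁ ^ 2) = _
    linear_combination W₀ k₀ * W₁ k₁ * g k₀ k₁ * h
  have hR : ((p₁ + p₂ : ℕ) - c : ℤ) * contraction p₀ p₁ p₂ c =
      -(∑ k₁ ∈ Finset.range (p₀ + p₁ + 1), W₁ k₁ * ∑ k₀ ∈ Finset.range (p₀ + p₂ + 1),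
          W₀ k₀ * lowerTerm (p₀ + p₂) (fun k => g k k₁) k₀ * f k₀ k₁) -
        (∑ k₀ ∈ Finset.range (p₀ + p₂ + 1), W₀ k₀ * ∑ k₁ ∈ Finset.range (p₀ + p₁ + 1),
          W₁ k₁ * lowerTerm (p₀ + p₁) (g k₀) k₁ * f k₀ k₁) := by
    simp only [contraction, Finset.mul_sum]
    rw [Finset.sum_comm (s := Finset.range (p₀ + p₁ + 1))]
    simp only [← Finset.sum_neg_distrib, ← Finset.sum_sub_distrib]
    refine Finset.sum_congr rfl fun k₀ _ => Finset.sum_congr rfl fun k₁ _ => ?_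
    have h := triTensor_lower p₀ p₁ p₂ k₀ k₁ c
    change lowerTerm (p₀ + p₂) (fun k => g k k₁) k₀ + lowerTerm (p₀ + p₁) (g k₀) k₁ +
      ((p₁ + p₂ : ℕ) - c : ℤ) * f k₀ k₁ = 0 at h
    change ((p₁ + p₂ : ℕ) - c : ℤ) * (W₀ k₀ * W₁ k₁ * f k₀ k₁ ^ 2) = _
    linear_combination W₀ k₀ * W₁ k₁ * f k₀ k₁ * h
  rw [hL, hR]
  refine congrArg₂ (fun x y => -x - y) ?_ ?_
  · refine Finset.sum_congr rfl fun k₁ _ => ?_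
    rw [sum_binWeight_shift (p₀ + p₂) (fun k => f k k₁) (fun k => g k k₁)
      (triTensor_eq_zero₀ (by omega))]
  · refine Finset.sum_congr rfl fun k₀ _ => ?_
    rw [sum_binWeight_shift (p₀ + p₁) (f k₀) (g k₀) (triTensor_eq_zero₁ (by omega))]

open MvPolynomial in
theorem triTensor_zero_right (p₀ p₁ p₂ k₀ k₁ : ℕ) :
    triTensor p₀ p₁ p₂ k₀ k₁ 0 = ∑ j ∈ Finset.range (p₀ + 1),
      if k₀ = j + p₂ ∧ k₁ = p₀ - j + p₁ then (-1) ^ (j + p₁) * (p₀.choose j : ℤ) else 0 := by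
  rw [triTensor_eq_coeff]
  -- Modulo `X 2` the last two factors become monomials, and the binomial theorem expands the first.
  obtain ⟨Q, hQ⟩ : (X 2 : MvPolynomial (Fin 3) ℤ) ∣
      triPoly p₀ p₁ p₂ - (X 1 - X 0) ^ p₀ * (-X 1) ^ p₁ * X 0 ^ p₂ := by
    have h1 : (X 2 : MvPolynomial (Fin 3) ℤ) ∣ (X 2 - X 1) ^ p₁ - (-X 1) ^ p₁ := by
      refine dvd_trans ?_ (sub_dvd_pow_sub_pow _ _ _)
      simp
    have h2 : (X 2 : MvPolynomial (Fin 3) ℤ) ∣ (X 0 - X 2) ^ p₂ - X 0 ^ p₂ := by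
      refine dvd_trans ?_ (sub_dvd_pow_sub_pow _ _ _)
      simp
    have e : triPoly p₀ p₁ p₂ - (X 1 - X 0) ^ p₀ * (-X 1) ^ p₁ * X 0 ^ p₂ =
        (X 1 - X 0) ^ p₀ * (X 0 - X 2) ^ p₂ * ((X 2 - X 1) ^ p₁ - (-X 1) ^ p₁) +
        (X 1 - X 0) ^ p₀ * (-X 1) ^ p₁ * ((X 0 - X 2) ^ p₂ - X 0 ^ p₂) := by
      rw [triPoly]; ring
    rw [e]
    exact dvd_add (h1.mul_left _) (h2.mul_left _)
  have h0 : triPoly p₀ p₁ p₂ = (X 1 - X 0) ^ p₀ * (-X 1) ^ p₁ * X 0 ^ p₂ + X 2 * Q := by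
    rw [← hQ]; ring
  have h3 : ((X 1 - X 0) ^ p₀ * (-X 1) ^ p₁ * X 0 ^ p₂ : MvPolynomial (Fin 3) ℤ) =
      ∑ j ∈ Finset.range (p₀ + 1), monomial (triExp (j + p₂) (p₀ - j + p₁) 0)
        ((-1) ^ (j + p₁) * (p₀.choose j : ℤ)) := by
    rw [sub_eq_neg_add, add_pow, Finset.sum_mul, Finset.sum_mul]
    refine Finset.sum_congr rfl fun j _ => ?_
    rw [monomial_eq, Finsupp.prod_fintype _ _ (by simp), Fin.prod_univ_three, triExp_zero,
      triExp_one, triExp_two]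
    simp only [map_mul, map_pow, map_neg, map_one, map_natCast]
    rw [neg_pow (X 0 : MvPolynomial (Fin 3) ℤ), neg_pow (X 1 : MvPolynomial (Fin 3) ℤ)]
    ring
  rw [h0, coeff_add, coeff_lower_of_eq_zero _ _ _ (triExp_two _ _ _), add_zero, h3, coeff_sum]
  refine Finset.sum_congr rfl fun j _ => ?_
  rw [coeff_monomial]
  refine if_congr ?_ rfl rfl
  constructor
  · intro h
    exact ⟨(DFunLike.congr_fun h 0).symm, (DFunLike.congr_fun h 1).symm⟩
  · rintro ⟨rfl, rfl⟩; rfl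

/-- At most one `j` satisfies the condition, so squaring the sum creates no cross terms. -/
theorem triTensor_zero_right_sq (p₀ p₁ p₂ k₀ k₁ : ℕ) :
    triTensor p₀ p₁ p₂ k₀ k₁ 0 ^ 2 = ∑ j ∈ Finset.range (p₀ + 1),
      if k₀ = j + p₂ ∧ k₁ = p₀ - j + p₁ then (p₀.choose j : ℤ) ^ 2 else 0 := by
  rw [triTensor_zero_right]
  by_cases h : ∃ j ∈ Finset.range (p₀ + 1), k₀ = j + p₂ ∧ k₁ = p₀ - j + p₁
  · obtain ⟨j, hj, h1, h2⟩ := h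
    have hne : ∀ i ∈ Finset.range (p₀ + 1), i ≠ j → ¬ (k₀ = i + p₂ ∧ k₁ = p₀ - i + p₁) := by
      intro i _ hij h'
      omega
    rw [Finset.sum_eq_single_of_mem j hj fun i hi hij => if_neg (hne i hi hij),
      Finset.sum_eq_single_of_mem j hj fun i hi hij => if_neg (hne i hi hij), if_pos ⟨h1, h2⟩,
      if_pos ⟨h1, h2⟩, mul_pow, ← pow_mul, mul_comm _ 2, pow_mul]
    simp
  · push Not at h
    rw [Finset.sum_eq_zero fun i hi => if_neg fun h' => h i hi h'.1 h'.2,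
      Finset.sum_eq_zero fun i hi => if_neg fun h' => h i hi h'.1 h'.2]
    simp

/-- The discrete form of `∫ x^A (1-x)^B (x + (1-x))^p` for beta integrals; here by induction with
Pascal's rule. -/
theorem sum_choose_mul_factorial (p A B : ℕ) :
    (∑ ij ∈ Finset.HasAntidiagonal.antidiagonal p, (p.choose ij.1 : ℤ) *
      (((A + ij.1).factorial : ℤ) * ((B + ij.2).factorial : ℤ))) * ((A + B + 1).factorial : ℤ) =
      (A.factorial : ℤ) * (B.factorial : ℤ) * ((A + B + p + 1).factorial : ℤ) := by
  induction p generalizing A B with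
  | zero => simp
  | succ p ih =>
    have h := Finset.sum_antidiagonal_choose_succ_mul
      (fun i j => ((A + i).factorial : ℤ) * ((B + j).factorial : ℤ)) p
    rw [h]
    have h1 := ih A (B + 1)
    have h2 := ih (A + 1) B
    have e1 : A + (B + 1) + 1 = A + B + 1 + 1 := by ring
    have e2 : A + 1 + B + 1 = A + B + 1 + 1 := by ring
    have e3 : A + (B + 1) + p + 1 = A + B + (p + 1) + 1 := by ring
    have e4 : A + 1 + B + p + 1 = A + B + (p + 1) + 1 := by ring
    rw [e1, e3, Nat.factorial_succ B, Nat.factorial_succ (A + B + 1)] at h1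
    rw [e2, e4, Nat.factorial_succ A, Nat.factorial_succ (A + B + 1)] at h2
    have s1 : ∑ ij ∈ Finset.HasAntidiagonal.antidiagonal p, (p.choose ij.1 : ℤ) *
        (((A + ij.1).factorial : ℤ) * ((B + (ij.2 + 1)).factorial : ℤ)) =
        ∑ ij ∈ Finset.HasAntidiagonal.antidiagonal p, (p.choose ij.1 : ℤ) *
        (((A + ij.1).factorial : ℤ) * ((B + 1 + ij.2).factorial : ℤ)) :=
      Finset.sum_congr rfl fun ij _ => by rw [show B + (ij.2 + 1) = B + 1 + ij.2 by ring]
    have s2 : ∑ ij ∈ Finset.HasAntidiagonal.antidiagonal p, (p.choose ij.2 : ℤ) *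
        (((A + (ij.1 + 1)).factorial : ℤ) * ((B + ij.2).factorial : ℤ)) =
        ∑ ij ∈ Finset.HasAntidiagonal.antidiagonal p, (p.choose ij.1 : ℤ) *
        (((A + 1 + ij.1).factorial : ℤ) * ((B + ij.2).factorial : ℤ)) :=
      Finset.sum_congr rfl fun ij hij => by
        rw [show A + (ij.1 + 1) = A + 1 + ij.1 by ring,
          Nat.choose_symm_of_eq_add (Finset.HasAntidiagonal.mem_antidiagonal.mp hij).symm]
    rw [s1, s2]
    push_cast at h1 h2
    have hne : (A + B + 1 + 1 : ℤ) ≠ 0 := by positivity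
    refine mul_left_cancel₀ hne ?_
    linear_combination h1 + h2

theorem contraction_zero (p₀ p₁ p₂ : ℕ) :
    contraction p₀ p₁ p₂ 0 * ((p₁ + p₂ + 1).factorial : ℤ) = vertexNorm p₀ p₁ p₂ := by
  have h1 : contraction p₀ p₁ p₂ 0 = ∑ j ∈ Finset.range (p₀ + 1),
      binWeight (p₀ + p₂) (j + p₂) * binWeight (p₀ + p₁) (p₀ - j + p₁) * (p₀.choose j : ℤ) ^ 2 := by
    simp only [contraction, triTensor_zero_right_sq, Finset.mul_sum]
    simp only [Finset.sum_comm (t := Finset.range (p₀ + 1))]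
    refine Finset.sum_congr rfl fun j hj => ?_
    have hj' := Finset.mem_range.mp hj
    rw [Finset.sum_eq_single_of_mem (j + p₂) (Finset.mem_range.mpr (by omega)),
      Finset.sum_eq_single_of_mem (p₀ - j + p₁) (Finset.mem_range.mpr (by omega))]
    · simp
    · intro k _ hk; simp [hk]
    · intro k _ hk; simp [hk]
  have h2 := sum_choose_mul_factorial p₀ p₂ p₁
  rw [Finset.Nat.sum_antidiagonal_eq_sum_range_succ_mk] at h2
  have h3 : contraction p₀ p₁ p₂ 0 = p₀.factorial * ∑ j ∈ Finset.range (p₀ + 1),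
      (p₀.choose j : ℤ) * (((p₂ + j).factorial : ℤ) * ((p₁ + (p₀ - j)).factorial : ℤ)) := by
    rw [h1, Finset.mul_sum]
    refine Finset.sum_congr rfl fun j hj => ?_
    have hj' : j ≤ p₀ := Nat.lt_succ_iff.mp (Finset.mem_range.mp hj)
    have hc : (p₀.choose j : ℤ) * (j.factorial : ℤ) * ((p₀ - j).factorial : ℤ) = p₀.factorial := by
      exact_mod_cast Nat.choose_mul_factorial_mul_factorial hj'
    rw [binWeight, binWeight, show p₀ + p₂ - (j + p₂) = p₀ - j by omega,
      show p₀ + p₁ - (p₀ - j + p₁) = j by omega, ← hc, add_comm j p₂, add_comm (p₀ - j) p₁]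
    ring
  rw [h3, add_comm p₁ p₂, mul_assoc]
  dsimp only at h2
  rw [h2, vertexNorm, show p₂ + p₁ + p₀ + 1 = p₀ + p₁ + p₂ + 1 by ring]
  push_cast
  ring

/-- The recursion in `c` is the one satisfied by the inverse of `binWeight`, so the product stays
equal to its explicit value at `c = 0`. -/
theorem contraction_eq (p₀ p₁ p₂ c : ℕ) (hc : c ≤ p₁ + p₂) :
    contraction p₀ p₁ p₂ c * binWeight (p₁ + p₂) c * (p₁ + p₂ + 1 : ℕ) = vertexNorm p₀ p₁ p₂ := by
  induction c with
  | zero =>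
    rw [← contraction_zero, binWeight, Nat.factorial_succ]
    simp
    ring
  | succ c ih =>
    rw [← ih (by omega)]
    refine congrArg (fun x : ℤ => x * (p₁ + p₂ + 1 : ℕ)) ?_
    have h := contraction_succ p₀ p₁ p₂ c
    obtain ⟨d, hd⟩ := Nat.exists_eq_add_of_lt (show c < p₁ + p₂ by omega)
    rw [binWeight, binWeight, hd, show c + d + 1 - (c + 1) = d by omega,
      show c + d + 1 - c = d + 1 by omega, Nat.factorial_succ, Nat.factorial_succ]
    rw [hd] at h
    push_cast at h ⊢
    linear_combination (c.factorial : ℤ) * d.factorial * h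

/-- Schur's lemma for the vertex tensor: contracting two half-edges gives a multiple of the
identity. -/
theorem schur_two (p₀ p₁ p₂ c c' : ℕ) (hc : c ≤ p₁ + p₂) :
    (∑ k₀ ∈ Finset.range (p₀ + p₂ + 1), ∑ k₁ ∈ Finset.range (p₀ + p₁ + 1),
      binWeight (p₀ + p₂) k₀ * binWeight (p₀ + p₁) k₁ *
        (triTensor p₀ p₁ p₂ k₀ k₁ c * triTensor p₀ p₁ p₂ k₀ k₁ c')) *
      (binWeight (p₁ + p₂) c * (p₁ + p₂ + 1 : ℕ)) =
    if c = c' then (vertexNorm p₀ p₁ p₂ : ℤ) else 0 := by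
  split_ifs with h
  · subst h
    rw [← contraction_eq p₀ p₁ p₂ c hc, contraction]
    simp only [sq]
    ring
  -- Off the diagonal, homogeneity fixes the third label once the first two are given.
  · rw [Finset.sum_eq_zero, zero_mul]
    refine fun k₀ _ => Finset.sum_eq_zero fun k₁ _ => ?_
    by_cases h1 : triTensor p₀ p₁ p₂ k₀ k₁ c = 0
    · simp [h1]
    by_cases h2 : triTensor p₀ p₁ p₂ k₀ k₁ c' = 0
    · simp [h2]
    have := triTensor_sum_eq h1
    have := triTensor_sum_eq h2
    omega

theorem vertexNorm_rotate (p₀ p₁ p₂ : ℕ) : vertexNorm p₁ p₂ p₀ = vertexNorm p₀ p₁ p₂ := by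
  rw [vertexNorm, vertexNorm, show p₁ + p₂ + p₀ + 1 = p₀ + p₁ + p₂ + 1 by ring]
  ring

theorem schur_zero (p₀ p₁ p₂ c c' : ℕ) (hc : c ≤ p₀ + p₂) :
    (∑ k₁ ∈ Finset.range (p₀ + p₁ + 1), ∑ k₂ ∈ Finset.range (p₁ + p₂ + 1),
      binWeight (p₀ + p₁) k₁ * binWeight (p₁ + p₂) k₂ *
        (triTensor p₀ p₁ p₂ c k₁ k₂ * triTensor p₀ p₁ p₂ c' k₁ k₂)) *
      (binWeight (p₀ + p₂) c * (p₀ + p₂ + 1 : ℕ)) =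
    if c = c' then (vertexNorm p₀ p₁ p₂ : ℤ) else 0 := by
  have h := schur_two p₁ p₂ p₀ c c' (by omega)
  simp only [triTensor_rotate, vertexNorm_rotate] at h
  rw [← h]
  simp only [add_comm p₂ p₀, add_comm p₁ p₀]

/-! ### Operator norms and traces of cyclic products. -/

section FormBound

variable {X : Type*} [Fintype X]

/-- The Euclidean norm of a vector. -/
noncomputable def l2norm (Y : X → ℝ) : ℝ :=
  √(∑ x, Y x ^ 2)

theorem l2norm_nonneg (Y : X → ℝ) : 0 ≤ l2norm Y := Real.sqrt_nonneg _

theorem l2norm_sq (Y : X → ℝ) : l2norm Y ^ 2 = ∑ x, Y x ^ 2 :=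
  Real.sq_sqrt (Finset.sum_nonneg fun _ _ => sq_nonneg _)

theorem abs_sum_mul_le_l2norm (Y Z : X → ℝ) : |∑ x, Y x * Z x| ≤ l2norm Y * l2norm Z := by
  rw [l2norm, l2norm, ← Real.sqrt_mul (Finset.sum_nonneg fun _ _ => sq_nonneg _)]
  exact Real.abs_le_sqrt (Finset.sum_mul_sq_le_sq_mul_sq _ _ _)

/-- The bilinear form with matrix `Q` is bounded by `C` for Euclidean norms. -/
def FormBound (Q : X → X → ℝ) (C : ℝ) : Prop :=
  ∀ Y Z : X → ℝ, |∑ y, ∑ z, Y y * Z z * Q y z| ≤ C * (l2norm Y * l2norm Z)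

/-- Test the form on the pair `(QZ, Z)` and divide by the norm of `QZ`. -/
theorem FormBound.l2norm_mulVec_le {Q : X → X → ℝ} {C : ℝ} (h : FormBound Q C) (hC : 0 ≤ C)
    (Z : X → ℝ) : l2norm (fun y => ∑ z, Q y z * Z z) ≤ C * l2norm Z := by
  set A : X → ℝ := fun y => ∑ z, Q y z * Z z with hA
  have h1 := h A Z
  have h2 : ∑ y, ∑ z, A y * Z z * Q y z = l2norm A ^ 2 := by
    rw [l2norm_sq]
    refine Finset.sum_congr rfl fun y _ => ?_
    rw [sq]
    conv_rhs => rw [hA]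
    rw [Finset.mul_sum]
    exact Finset.sum_congr rfl fun z _ => by ring
  rw [h2, abs_of_nonneg (sq_nonneg _)] at h1
  rcases (l2norm_nonneg A).eq_or_lt with h0 | h0
  · rw [← h0]
    exact mul_nonneg hC (l2norm_nonneg Z)
  · nlinarith

theorem FormBound.l2norm_col_le [DecidableEq X] {Q : X → X → ℝ} {C : ℝ} (h : FormBound Q C)
    (hC : 0 ≤ C) (w : X) : l2norm (fun y => Q y w) ≤ C := by
  have h1 := h.l2norm_mulVec_le hC (fun z => if z = w then 1 else 0)
  simpa [l2norm] using h1

/-- The bound for sums over open paths. -/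
theorem abs_sum_path_le (t : ℕ) (Q : Fin t → X → X → ℝ) (C : Fin t → ℝ) (hC : ∀ i, 0 ≤ C i)
    (hQ : ∀ i, FormBound (Q i) (C i)) (A B : X → ℝ) :
    |∑ x : Fin (t + 1) → X, A (x 0) * B (x (Fin.last t)) *
      ∏ i, Q i (x i.succ) (x i.castSucc)| ≤ (∏ i, C i) * (l2norm A * l2norm B) := by
  induction t generalizing A with
  | zero =>
    rw [← Equiv.sum_comp (Equiv.funUnique (Fin 1) X).symm]
    simpa using abs_sum_mul_le_l2norm A B
  | succ t ih =>
    -- The first matrix is absorbed into the initial vector.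
    have h1 := ih (fun i => Q i.succ) (fun i => C i.succ) (fun i => hC _) (fun i => hQ _)
      (fun z => ∑ y, Q 0 z y * A y)
    have h2 : ∑ x : Fin (t + 1 + 1) → X, A (x 0) * B (x (Fin.last (t + 1))) *
        ∏ i, Q i (x i.succ) (x i.castSucc) =
        ∑ x : Fin (t + 1) → X, (∑ y, Q 0 (x 0) y * A y) * B (x (Fin.last t)) *
          ∏ i, Q (Fin.succ i) (x i.succ) (x i.castSucc) := by
      rw [← Equiv.sum_comp (Fin.consEquiv fun _ => X), Fintype.sum_prod_type, Finset.sum_comm]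
      refine Finset.sum_congr rfl fun x _ => ?_
      rw [Finset.sum_mul, Finset.sum_mul]
      refine Finset.sum_congr rfl fun y _ => ?_
      rw [Fin.prod_univ_succ]
      simp only [Fin.consEquiv_apply, Fin.cons_zero, Fin.cons_succ, ← Fin.succ_last,
        Fin.castSucc_zero, Fin.castSucc_succ]
      ring
    rw [h2]
    refine h1.trans ?_
    rw [Fin.prod_univ_succ]
    have h3 := (hQ 0).l2norm_mulVec_le (hC 0) A
    have h4 : 0 ≤ ∏ i : Fin t, C i.succ := Finset.prod_nonneg fun i _ => hC _
    have h5 := mul_le_mul_of_nonneg_left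
      (mul_le_mul_of_nonneg_right h3 (l2norm_nonneg B)) h4
    linarith

/-- The bound for traces, when the columns of the first matrix are supported in `R`. -/
theorem abs_sum_cycle_le_aux (t : ℕ) (Q : Fin (t + 1) → X → X → ℝ) (C : Fin (t + 1) → ℝ)
    (hC : ∀ i, 0 ≤ C i) (hQ : ∀ i, FormBound (Q i) (C i)) (R : Finset X)
    (hR : ∀ y z, z ∉ R → Q 0 y z = 0) :
    |∑ x : Fin (t + 1) → X, ∏ i, Q i (x i) (x (i - 1))| ≤ R.card * ∏ i, C i := by
  classical
  -- Cut the cycle before position `0`. For each value `w ∈ R` at the cut there remains an open path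
  -- from the column `w` of `Q 0` to a basis vector.
  have h1 : ∀ x : Fin (t + 1) → X, ∏ i, Q i (x i) (x (i - 1)) =
      ∑ w ∈ R, (Q 0 (x 0) w * (if x (Fin.last t) = w then 1 else 0) *
        ∏ i : Fin t, Q i.succ (x i.succ) (x i.castSucc)) := by
    intro x
    have e0 : (0 : Fin (t + 1)) - 1 = Fin.last t := by
      rw [sub_eq_iff_eq_add, Fin.last_add_one]
    have e1 : ∀ i : Fin t, i.succ - 1 = i.castSucc := fun i => by
      rw [sub_eq_iff_eq_add, Fin.coeSucc_eq_succ]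
    rw [Fin.prod_univ_succ, e0, ← Finset.sum_mul]
    simp only [e1]
    congr 1
    by_cases h : x (Fin.last t) ∈ R
    · simp [h]
    · rw [hR _ _ h]
      simp [h]
  simp_rw [h1]
  rw [Finset.sum_comm]
  refine (Finset.abs_sum_le_sum_abs _ _).trans ?_
  rw [← nsmul_eq_mul]
  refine Finset.sum_le_card_nsmul _ _ _ fun w _ => ?_
  have h2 := abs_sum_path_le t (fun i => Q i.succ) (fun i => C i.succ) (fun i => hC _)
    (fun i => hQ _) (fun y => Q 0 y w) (fun z => if z = w then 1 else 0)
  refine h2.trans ?_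
  have h3 : l2norm (fun z : X => if z = w then (1 : ℝ) else 0) = 1 := by simp [l2norm]
  rw [h3, mul_one, Fin.prod_univ_succ, mul_comm]
  exact mul_le_mul_of_nonneg_right ((hQ 0).l2norm_col_le (hC 0) w)
    (Finset.prod_nonneg fun i _ => hC _)

/-- The bound for traces of cyclic products. -/
theorem abs_sum_cycle_le {s : ℕ} [NeZero s] (Q : Fin s → X → X → ℝ) (C : Fin s → ℝ)
    (hC : ∀ i, 0 ≤ C i) (hQ : ∀ i, FormBound (Q i) (C i)) (j : Fin s) (R : Finset X)
    (hR : ∀ y z, z ∉ R → Q (j + 1) y z = 0) :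
    |∑ x : Fin s → X, ∏ i, Q i (x i) (x (i - 1))| ≤ R.card * ∏ i, C i := by
  obtain ⟨t, rfl⟩ : ∃ t, s = t + 1 := ⟨s - 1, (Nat.succ_pred_eq_of_ne_zero (NeZero.ne s)).symm⟩
  -- Rotating the cycle brings the matrix with known support to position `0`.
  have h := abs_sum_cycle_le_aux t (fun i => Q (i + (j + 1))) (fun i => C (i + (j + 1)))
    (fun i => hC _) (fun i => hQ _) R (fun y z hz => by rw [zero_add]; exact hR y z hz)
  have h1 : ∏ i, C (i + (j + 1)) = ∏ i, C i := Equiv.prod_comp (Equiv.addRight (j + 1)) C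
  have h2 : ∑ x : Fin (t + 1) → X, ∏ i, Q (i + (j + 1)) (x i) (x (i - 1)) =
      ∑ x : Fin (t + 1) → X, ∏ i, Q i (x i) (x (i - 1)) := by
    rw [← Equiv.sum_comp (Equiv.arrowCongr (Equiv.addRight (j + 1)).symm (Equiv.refl X))]
    refine Finset.sum_congr rfl fun x _ => ?_
    rw [← Equiv.prod_comp (Equiv.addRight (j + 1)) fun i => Q i (x i) (x (i - 1))]
    refine Finset.prod_congr rfl fun i _ => ?_
    change Q (i + (j + 1)) (x (i + (j + 1))) (x (i - 1 + (j + 1))) =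
      Q (i + (j + 1)) (x (i + (j + 1))) (x (i + (j + 1) - 1))
    rw [sub_add_eq_add_sub]
  rw [h1, h2] at h
  exact h

/-- Pythagoras for the orthogonal rows of `K`, whose squared norms are the `d y`. -/
theorem sum_sq_le_of_orthogonal {A B : Type*} [Fintype A] [Fintype B] [DecidableEq A]
    (K : A → B → ℝ) (d : A → ℝ) (c : ℝ)
    (hK : ∀ y y', ∑ b, K y b * K y' b = if y = y' then d y else 0) (hd : ∀ y, d y ≤ c)
    (f : A → ℝ) : ∑ b, (∑ y, f y * K y b) ^ 2 ≤ c * ∑ y, f y ^ 2 := by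
  have h1 : ∑ b, (∑ y, f y * K y b) ^ 2 = ∑ y, f y ^ 2 * d y := by
    simp_rw [sq, Finset.sum_mul_sum]
    rw [Finset.sum_comm]
    refine Finset.sum_congr rfl fun y _ => ?_
    rw [Finset.sum_comm]
    have h2 : ∀ y', ∑ b, f y * K y b * (f y' * K y' b) =
        f y * f y' * (if y = y' then d y else 0) := by
      intro y'
      rw [← hK, Finset.mul_sum]
      exact Finset.sum_congr rfl fun b _ => by ring
    simp [h2]
  rw [h1, Finset.mul_sum]
  refine Finset.sum_le_sum fun y _ => ?_
  rw [mul_comm]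
  exact mul_le_mul_of_nonneg_right (hd y) (sq_nonneg _)

/-- The bound for a transfer matrix which is a sum of tensor products `K r ⊗ L r`. -/
theorem formBound_of_contractions {A R : Type*} [Fintype A] [Fintype R] (K L : A → A → R → ℝ)
    (cK cL : ℝ) (hcK : 0 ≤ cK) (hcL : 0 ≤ cL)
    (hK : ∀ f : A → ℝ, ∑ b : A × R, (∑ y, f y * K y b.1 b.2) ^ 2 ≤ cK * ∑ y, f y ^ 2)
    (hL : ∀ f : A → ℝ, ∑ b : A × R, (∑ z, f z * L b.1 z b.2) ^ 2 ≤ cL * ∑ z, f z ^ 2) :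
    FormBound (fun y z : A × A => ∑ r, K y.1 z.1 r * L y.2 z.2 r) √(cK * cL) := by
  intro Y Z
  -- `K` is applied to `Y` through its first leg and `L` to `Z` through its second. The form is then
  -- the scalar product of `U` and `W`, and Cauchy–Schwarz separates the two vertices.
  let U : A × A × R → ℝ := fun w => ∑ y₀, Y (y₀, w.1) * K y₀ w.2.1 w.2.2
  let W : A × A × R → ℝ := fun w => ∑ z₁, Z (w.2.1, z₁) * L w.1 z₁ w.2.2
  have h1 : ∑ y, ∑ z, Y y * Z z * ∑ r, K y.1 z.1 r * L y.2 z.2 r = ∑ w, U w * W w := by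
    simp only [U, W, Fintype.sum_prod_type, Finset.mul_sum, Finset.sum_mul]
    rw [Finset.sum_comm]
    refine Finset.sum_congr rfl fun y₁ _ => ?_
    rw [Finset.sum_comm]
    refine Finset.sum_congr rfl fun z₀ _ => ?_
    simp only [Finset.sum_comm (s := (Finset.univ : Finset A)) (t := (Finset.univ : Finset R))]
    refine Finset.sum_congr rfl fun r _ => ?_
    rw [Finset.sum_comm]
    refine Finset.sum_congr rfl fun z₁ _ => Finset.sum_congr rfl fun y₀ _ => ?_
    ring
  have h2 : l2norm U ^ 2 ≤ cK * l2norm Y ^ 2 :=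
    calc l2norm U ^ 2 = ∑ y₁, ∑ b : A × R, (∑ y₀, Y (y₀, y₁) * K y₀ b.1 b.2) ^ 2 := by
          rw [l2norm_sq, Fintype.sum_prod_type]
      _ ≤ ∑ y₁, cK * ∑ y₀, Y (y₀, y₁) ^ 2 :=
          Finset.sum_le_sum fun y₁ _ => hK fun y₀ => Y (y₀, y₁)
      _ = cK * l2norm Y ^ 2 := by
          rw [l2norm_sq, ← Finset.mul_sum, Fintype.sum_prod_type, Finset.sum_comm]
  have h3 : l2norm W ^ 2 ≤ cL * l2norm Z ^ 2 :=
    calc l2norm W ^ 2 = ∑ z₀, ∑ b : A × R, (∑ z₁, Z (z₀, z₁) * L b.1 z₁ b.2) ^ 2 := by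
          rw [l2norm_sq]
          simp only [Fintype.sum_prod_type]
          rw [Finset.sum_comm]
      _ ≤ ∑ z₀, cL * ∑ z₁, Z (z₀, z₁) ^ 2 :=
          Finset.sum_le_sum fun z₀ _ => hL fun z₁ => Z (z₀, z₁)
      _ = cL * l2norm Z ^ 2 := by
          rw [l2norm_sq, ← Finset.mul_sum, Fintype.sum_prod_type]
  rw [h1]
  refine (abs_sum_mul_le_l2norm U W).trans ?_
  have h4 : l2norm U ≤ √cK * l2norm Y := by
    rw [← abs_of_nonneg (l2norm_nonneg U)]
    refine abs_le_of_sq_le_sq ?_ (mul_nonneg (Real.sqrt_nonneg _) (l2norm_nonneg _))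
    rw [mul_pow, Real.sq_sqrt hcK]; exact h2
  have h5 : l2norm W ≤ √cL * l2norm Z := by
    rw [← abs_of_nonneg (l2norm_nonneg W)]
    refine abs_le_of_sq_le_sq ?_ (mul_nonneg (Real.sqrt_nonneg _) (l2norm_nonneg _))
    rw [mul_pow, Real.sq_sqrt hcL]; exact h3
  rw [Real.sqrt_mul hcK]
  calc l2norm U * l2norm W ≤ (√cK * l2norm Y) * (√cL * l2norm Z) :=
        mul_le_mul h4 h5 (l2norm_nonneg _) (mul_nonneg (Real.sqrt_nonneg _) (l2norm_nonneg _))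
    _ = _ := by ring

end FormBound

/-! ### Vertex tensors in orthonormal bases and the transfer matrices. -/

/-- The norm of the state with `k` labels `true` on `n` strands, which is `0` for `n < k`. -/
noncomputable def stateNorm (n k : ℕ) : ℝ :=
  if k ≤ n then √(binWeight n k : ℝ) else 0

theorem stateNorm_sq (n k : ℕ) :
    stateNorm n k ^ 2 = if k ≤ n then (binWeight n k : ℝ) else 0 := by
  rw [stateNorm]
  split_ifs
  · rw [Real.sq_sqrt]; exact_mod_cast (binWeight_pos n k).le
  · simp

theorem sum_stateNorm_sq {N n : ℕ} (h : n < N) (f : ℕ → ℝ) :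
    ∑ k : Fin N, stateNorm n k ^ 2 * f k =
      ∑ k ∈ Finset.range (n + 1), (binWeight n k : ℝ) * f k := by
  rw [Fin.sum_univ_eq_sum_range (fun k => stateNorm n k ^ 2 * f k) N]
  symm
  refine Finset.sum_subset_zero_on_sdiff (Finset.range_mono h) ?_ ?_
  · intro k hk
    simp only [Finset.mem_sdiff, Finset.mem_range, not_lt] at hk
    rw [stateNorm_sq, if_neg (by omega), zero_mul]
  · intro k hk
    rw [stateNorm_sq, if_pos (Nat.lt_succ_iff.mp (Finset.mem_range.mp hk))]

theorem sum_stateNorm_sq_sub {N n : ℕ} (h : n < N) (f : ℕ → ℝ) :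
    ∑ k : Fin N, stateNorm n k ^ 2 * f (n - k) =
      ∑ k ∈ Finset.range (n + 1), (binWeight n k : ℝ) * f k := by
  rw [sum_stateNorm_sq h fun k => f (n - k),
    ← Finset.sum_flip fun k => (binWeight n k : ℝ) * f k]
  refine Finset.sum_congr rfl fun k hk => ?_
  rw [binWeight_sub (Nat.lt_succ_iff.mp (Finset.mem_range.mp hk))]

section Kernels

variable (n₀ n₁ n₂ p₀ p₁ p₂ : ℕ)

/-- The normalized tensor of an inner vertex. -/
noncomputable def innerKernel {N : ℕ} (y z r : Fin N) : ℝ :=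
  (-1) ^ (y : ℕ) * stateNorm n₀ y * stateNorm n₁ z * stateNorm n₂ r *
    triTensor p₀ p₁ p₂ y (n₁ - z) r

/-- The normalized tensor of an outer vertex. -/
noncomputable def outerKernel {N : ℕ} (y z r : Fin N) : ℝ :=
  (-1) ^ (y + r : ℕ) * stateNorm n₀ y * stateNorm n₁ r * stateNorm n₂ z *
    triTensor p₀ p₁ p₂ y (n₁ - r) (n₂ - z)

variable {n₀ n₁ n₂ p₀ p₁ p₂}

/-- Schur's lemma with the outgoing arc left open; the reversal `n₁ - z` of the incoming label
preserves the weights. -/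
theorem sum_innerKernel {N : ℕ} (h₀ : p₀ + p₂ = n₀) (h₁ : p₀ + p₁ = n₁) (h₂ : p₁ + p₂ = n₂)
    (hN₁ : n₁ < N) (hN₂ : n₂ < N) (y y' : Fin N) :
    ∑ b : Fin N × Fin N, innerKernel n₀ n₁ n₂ p₀ p₁ p₂ y b.1 b.2 *
      innerKernel n₀ n₁ n₂ p₀ p₁ p₂ y' b.1 b.2 =
    if y = y' then (if (y : ℕ) ≤ n₀ then (vertexNorm p₀ p₁ p₂ : ℝ) / (n₀ + 1) else 0) else 0 := by
  have h1 : ∑ b : Fin N × Fin N, innerKernel n₀ n₁ n₂ p₀ p₁ p₂ y b.1 b.2 *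
      innerKernel n₀ n₁ n₂ p₀ p₁ p₂ y' b.1 b.2 =
      ((-1) ^ (y : ℕ) * (-1) ^ (y' : ℕ) * (stateNorm n₀ y * stateNorm n₀ y')) *
      ∑ k₁ ∈ Finset.range (n₁ + 1), ∑ k₂ ∈ Finset.range (n₂ + 1),
        (binWeight n₁ k₁ : ℝ) * binWeight n₂ k₂ *
          (triTensor p₀ p₁ p₂ y k₁ k₂ * triTensor p₀ p₁ p₂ y' k₁ k₂) := by
    have e1 : ∀ k₁, ∑ k₂ ∈ Finset.range (n₂ + 1), (binWeight n₁ k₁ : ℝ) * binWeight n₂ k₂ *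
          (triTensor p₀ p₁ p₂ y k₁ k₂ * triTensor p₀ p₁ p₂ y' k₁ k₂ : ℝ) =
        (binWeight n₁ k₁ : ℝ) * ∑ r : Fin N, stateNorm n₂ r ^ 2 *
          (triTensor p₀ p₁ p₂ y k₁ r * triTensor p₀ p₁ p₂ y' k₁ r : ℝ) := by
      intro k₁
      rw [sum_stateNorm_sq hN₂ fun r =>
        (triTensor p₀ p₁ p₂ y k₁ r * triTensor p₀ p₁ p₂ y' k₁ r : ℝ), Finset.mul_sum]
      exact Finset.sum_congr rfl fun _ _ => by ring
    simp_rw [e1]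
    rw [← sum_stateNorm_sq_sub hN₁ fun k₁ => ∑ r : Fin N, stateNorm n₂ r ^ 2 *
          (triTensor p₀ p₁ p₂ y k₁ r * triTensor p₀ p₁ p₂ y' k₁ r : ℝ), Fintype.sum_prod_type,
      Finset.mul_sum]
    refine Finset.sum_congr rfl fun z _ => ?_
    rw [Finset.mul_sum, Finset.mul_sum]
    refine Finset.sum_congr rfl fun r _ => ?_
    rw [innerKernel, innerKernel]
    ring
  rw [h1]
  by_cases hy : (y : ℕ) ≤ n₀
  · have h2 := congrArg (Int.cast : ℤ → ℝ) (schur_zero p₀ p₁ p₂ y y' (by omega))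
    rw [h₀, h₁, h₂] at h2
    push_cast at h2
    have hW : (0 : ℝ) < binWeight n₀ y := by exact_mod_cast binWeight_pos n₀ y
    have hn : (0 : ℝ) < n₀ + 1 := by positivity
    by_cases hyy : y = y'
    · subst hyy
      rw [if_pos rfl] at h2
      rw [if_pos rfl, if_pos hy, eq_div_iff hn.ne', ← h2, ← sq, ← pow_mul, mul_comm _ 2, pow_mul,
        ← sq, stateNorm_sq, if_pos hy]
      simp only [even_two, Even.neg_pow, one_pow, one_mul]
      ring
    · rw [if_neg fun h => hyy (Fin.ext h)] at h2
      rw [if_neg hyy, (mul_eq_zero.mp h2).resolve_right (mul_pos hW hn).ne', mul_zero]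
  · have : stateNorm n₀ y = 0 := by rw [stateNorm, if_neg hy]
    rw [this, if_neg hy]
    simp

theorem sum_outerKernel {N : ℕ} (h₀ : p₀ + p₂ = n₀) (h₁ : p₀ + p₁ = n₁) (h₂ : p₁ + p₂ = n₂)
    (hN₀ : n₀ < N) (hN₁ : n₁ < N) (z z' : Fin N) :
    ∑ b : Fin N × Fin N, outerKernel n₀ n₁ n₂ p₀ p₁ p₂ b.1 z b.2 *
      outerKernel n₀ n₁ n₂ p₀ p₁ p₂ b.1 z' b.2 =
    if z = z' then (if (z : ℕ) ≤ n₂ then (vertexNorm p₀ p₁ p₂ : ℝ) / (n₂ + 1) else 0) else 0 := by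
  have h1 : ∑ b : Fin N × Fin N, outerKernel n₀ n₁ n₂ p₀ p₁ p₂ b.1 z b.2 *
      outerKernel n₀ n₁ n₂ p₀ p₁ p₂ b.1 z' b.2 =
      (stateNorm n₂ z * stateNorm n₂ z') *
      ∑ k₀ ∈ Finset.range (n₀ + 1), ∑ k₁ ∈ Finset.range (n₁ + 1),
        (binWeight n₀ k₀ : ℝ) * binWeight n₁ k₁ *
          (triTensor p₀ p₁ p₂ k₀ k₁ (n₂ - z) * triTensor p₀ p₁ p₂ k₀ k₁ (n₂ - z')) := by
    have e1 : ∀ k₀, ∑ k₁ ∈ Finset.range (n₁ + 1), (binWeight n₀ k₀ : ℝ) * binWeight n₁ k₁ *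
          (triTensor p₀ p₁ p₂ k₀ k₁ (n₂ - z) * triTensor p₀ p₁ p₂ k₀ k₁ (n₂ - z') : ℝ) =
        (binWeight n₀ k₀ : ℝ) * ∑ r : Fin N, stateNorm n₁ r ^ 2 *
          (triTensor p₀ p₁ p₂ k₀ (n₁ - r) (n₂ - z) *
            triTensor p₀ p₁ p₂ k₀ (n₁ - r) (n₂ - z') : ℝ) := by
      intro k₀
      rw [sum_stateNorm_sq_sub hN₁ fun r =>
        (triTensor p₀ p₁ p₂ k₀ r (n₂ - z) * triTensor p₀ p₁ p₂ k₀ r (n₂ - z') : ℝ),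
        Finset.mul_sum]
      exact Finset.sum_congr rfl fun _ _ => by ring
    simp_rw [e1]
    rw [← sum_stateNorm_sq hN₀ fun k₀ => ∑ r : Fin N, stateNorm n₁ r ^ 2 *
          (triTensor p₀ p₁ p₂ k₀ (n₁ - r) (n₂ - z) *
            triTensor p₀ p₁ p₂ k₀ (n₁ - r) (n₂ - z') : ℝ), Fintype.sum_prod_type,
      Finset.mul_sum]
    refine Finset.sum_congr rfl fun y _ => ?_
    rw [Finset.mul_sum, Finset.mul_sum]
    refine Finset.sum_congr rfl fun r _ => ?_
    rw [outerKernel, outerKernel]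
    have hs : ((-1 : ℝ) ^ (y + r : ℕ)) * ((-1 : ℝ) ^ (y + r : ℕ)) = 1 := by
      rw [← mul_pow]; simp
    linear_combination stateNorm n₀ y ^ 2 * stateNorm n₁ r ^ 2 * stateNorm n₂ z *
      stateNorm n₂ z' * triTensor p₀ p₁ p₂ y (n₁ - r) (n₂ - z) *
      triTensor p₀ p₁ p₂ y (n₁ - r) (n₂ - z') * hs
  rw [h1]
  by_cases hz : (z : ℕ) ≤ n₂
  -- Needed because the truncated `n₂ - z'` separates labels only up to `n₂`; beyond that the kernel
  -- vanishes through `stateNorm`.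
  · by_cases hz' : (z' : ℕ) ≤ n₂
    · have h2 := congrArg (Int.cast : ℤ → ℝ) (schur_two p₀ p₁ p₂ (n₂ - z) (n₂ - z') (by omega))
      rw [h₀, h₁, h₂, binWeight_sub hz] at h2
      push_cast at h2
      have hW : (0 : ℝ) < binWeight n₂ z := by exact_mod_cast binWeight_pos n₂ z
      have hn : (0 : ℝ) < n₂ + 1 := by positivity
      by_cases hzz : z = z'
      · subst hzz
        rw [if_pos rfl] at h2
        rw [if_pos rfl, if_pos hz, eq_div_iff hn.ne', ← h2, ← sq, stateNorm_sq, if_pos hz]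
        ring
      · have hne : n₂ - (z : ℕ) ≠ n₂ - z' := fun h => hzz (Fin.ext (by omega))
        rw [if_neg hne] at h2
        rw [if_neg hzz, (mul_eq_zero.mp h2).resolve_right (mul_pos hW hn).ne', mul_zero]
    · have : stateNorm n₂ z' = 0 := by rw [stateNorm, if_neg hz']
      rw [this, if_neg fun h : z = z' => hz' (h ▸ hz)]
      simp
  · have : stateNorm n₂ z = 0 := by rw [stateNorm, if_neg hz]
    rw [this, if_neg hz]
    simp

end Kernels

/-- The transfer matrix between consecutive pairs of arcs is bounded. -/
theorem formBound_transfer {N a a' b p₀ p₁ p₂ q₀ q₁ q₂ : ℕ}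
    (hp₀ : p₀ + p₂ = a) (hp₁ : p₀ + p₁ = a') (hp₂ : p₁ + p₂ = b)
    (hq₀ : q₀ + q₂ = a) (hq₁ : q₀ + q₁ = b) (hq₂ : q₁ + q₂ = a')
    (ha : a < N) (ha' : a' < N) (hb : b < N) :
    FormBound (fun y z : Fin N × Fin N => ∑ r,
      innerKernel a a' b p₀ p₁ p₂ y.1 z.1 r * outerKernel a b a' q₀ q₁ q₂ y.2 z.2 r)
      √((vertexNorm p₀ p₁ p₂ : ℝ) / (a + 1) * ((vertexNorm q₀ q₁ q₂ : ℝ) / (a' + 1))) := by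
  have hle : ∀ (n k S : ℕ), (if k ≤ n then (S : ℝ) / (n + 1) else 0) ≤ (S : ℝ) / (n + 1) := by
    intro n k S
    split_ifs
    · exact le_rfl
    · positivity
  refine formBound_of_contractions _ _ _ _ (by positivity) (by positivity) (fun f => ?_)
    (fun f => ?_)
  · exact sum_sq_le_of_orthogonal
      (fun y (b' : Fin N × Fin N) => innerKernel a a' b p₀ p₁ p₂ y b'.1 b'.2) _ _
      (sum_innerKernel hp₀ hp₁ hp₂ ha' hb) (fun y => hle _ _ _) f
  · exact sum_sq_le_of_orthogonal
      (fun z (b' : Fin N × Fin N) => outerKernel a b a' q₀ q₁ q₂ b'.1 z b'.2) _ _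
      (sum_outerKernel hq₀ hq₁ hq₂ ha hb) (fun y => hle _ _ _) f

/-! ### The unitary normalization, and label sets of uniform size. -/

namespace CubicRibbonGraph

/-- The norm of the tensor at the vertex `v`. -/
noncomputable def normAt {V E : Type*} (G : CubicRibbonGraph V E) (γ : E → ℕ) (v : V) : ℝ :=
  vertexNorm (G.joinCount γ v 0) (G.joinCount γ v 1) (G.joinCount γ v 2)

theorem normAt_pos {V E : Type*} (G : CubicRibbonGraph V E) (γ : E → ℕ) (v : V) :
    0 < G.normAt γ v := by
  unfold normAt vertexNorm; positivity

/-- The squared norm of a vertex tensor is the square of the corner factorials times `theta`, so the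
two normalizations combine into division by the norm. -/
theorem unitaryEval_eq {V E : Type*} [Fintype V] [Fintype E] [DecidableEq E]
    {G : CubicRibbonGraph V E} {γ : E → ℕ} (h : G.Admissible γ) :
    G.unitaryEval γ = (G.penroseEval γ : ℝ) * ∏ v, (√(G.normAt γ v))⁻¹ := by
  rw [unitaryEval, standardEval, mul_assoc, ← Finset.prod_mul_distrib]
  congr 1
  refine Finset.prod_congr rfl fun v _ => ?_
  rw [← mul_inv]
  congr 1
  have hc : cornerFactorial (G.decorationAt γ v 0) (G.decorationAt γ v 1)
      (G.decorationAt γ v 2) = (G.joinCount γ v 0).factorial * (G.joinCount γ v 1).factorial *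
        (G.joinCount γ v 2).factorial := by
    rw [cornerFactorial, mul_right_comm]
    congr 3
    change _ = G.decorationAt γ v 2 + G.decorationAt γ v 0 - G.decorationAt γ v 1
    rw [add_comm (G.decorationAt γ v 2)]
  have hJ : (G.decorationAt γ v 0 + G.decorationAt γ v 1 + G.decorationAt γ v 2) / 2 =
      G.joinCount γ v 0 + G.joinCount γ v 1 + G.joinCount γ v 2 := by
    have h0 := h.joinCount_add v 0
    have h1 := h.joinCount_add v 1
    have h2 := h.joinCount_add v 2
    simp only [zero_add, show (1 : Fin 3) + 1 = 2 from rfl, show (2 : Fin 3) + 1 = 0 from rfl] at *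
    omega
  have hpos : (0 : ℝ) < (cornerFactorial (G.decorationAt γ v 0) (G.decorationAt γ v 1)
      (G.decorationAt γ v 2) : ℝ) := by
    unfold cornerFactorial; positivity
  have key : G.normAt γ v = (cornerFactorial (G.decorationAt γ v 0) (G.decorationAt γ v 1)
      (G.decorationAt γ v 2) : ℝ) ^ 2 * theta (G.decorationAt γ v 0) (G.decorationAt γ v 1)
      (G.decorationAt γ v 2) := by
    rw [theta, sq, mul_assoc, mul_div_cancel₀ _ hpos.ne', hJ, hc, normAt, vertexNorm]
    push_cast
    ring
  rw [key, Real.sqrt_mul (sq_nonneg _), Real.sqrt_sq hpos.le]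

end CubicRibbonGraph

/-- A common label set `Fin N` makes all transfer matrices square of one size; `stateNorm` kills the
superfluous labels. -/
theorem sum_piFinset_range_eq {E : Type*} [Fintype E] [DecidableEq E] {N : ℕ} (γ : E → ℕ)
    (hN : ∀ e, γ e < N) (F : (E → ℕ) → ℝ) :
    ∑ m ∈ Fintype.piFinset (fun e => Finset.range (γ e + 1)),
      (∏ e, (-1) ^ m e * ((m e).factorial : ℝ) * ((γ e - m e).factorial : ℝ)) * F m =
    ∑ m : E → Fin N, (∏ e, (-1) ^ (m e : ℕ) * stateNorm (γ e) (m e) ^ 2) *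
      F (fun e => (m e : ℕ)) := by
  symm
  have hle : ∀ (m : E → Fin N), (∏ e, (-1) ^ (m e : ℕ) * stateNorm (γ e) (m e) ^ 2) ≠ 0 →
      ∀ e, (m e : ℕ) ≤ γ e := by
    intro m hm e
    by_contra h
    refine hm (Finset.prod_eq_zero (Finset.mem_univ e) ?_)
    rw [stateNorm, if_neg h]
    simp
  refine Finset.sum_bij_ne_zero (fun m _ _ e => (m e : ℕ)) ?_ ?_ ?_ ?_
  · intro m _ hm
    rw [Fintype.mem_piFinset]
    intro e
    exact Finset.mem_range.mpr (Nat.lt_succ_of_le (hle m (left_ne_zero_of_mul hm) e))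
  · intro m _ _ m' _ _ h
    funext e
    exact Fin.ext (congrFun h e)
  · intro m hm hne
    rw [Fintype.mem_piFinset] at hm
    have hm' : ∀ e, m e ≤ γ e := fun e => Nat.lt_succ_iff.mp (Finset.mem_range.mp (hm e))
    refine ⟨fun e => ⟨m e, (hm' e).trans_lt (hN e)⟩, Finset.mem_univ _, ?_, rfl⟩
    refine mul_ne_zero (Finset.prod_ne_zero_iff.mpr fun e _ => ?_) (right_ne_zero_of_mul hne)
    rw [stateNorm_sq, if_pos (hm' e)]
    have : (binWeight (γ e) (m e) : ℝ) ≠ 0 := by exact_mod_cast (binWeight_pos _ _).ne'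
    exact mul_ne_zero (pow_ne_zero _ (by norm_num)) this
  · intro m _ hm
    congr 1
    refine Finset.prod_congr rfl fun e _ => ?_
    rw [stateNorm_sq, if_pos (hle m (left_ne_zero_of_mul hm) e), binWeight]
    push_cast
    ring

/-! ### The drum as a trace of transfer matrices. -/

section Drum

variable {s : ℕ} [NeZero s] {a b : Fin s → ℕ}

/-- The numbers of strands at the vertices of the drum. -/
abbrev drumJoin (a b : Fin s → ℕ) (v : Fin s × Bool) (i : Fin 3) : ℕ :=
  (drum s).joinCount (drumDecoration a b) v i

theorem drumJoin_inner (h : (drum s).Admissible (drumDecoration a b)) (i : Fin s) :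
    drumJoin a b (i, false) 0 + drumJoin a b (i, false) 2 = a i ∧
    drumJoin a b (i, false) 0 + drumJoin a b (i, false) 1 = a (i - 1) ∧
    drumJoin a b (i, false) 1 + drumJoin a b (i, false) 2 = b i :=
  ⟨(add_comm _ _).trans (h.joinCount_add (i, false) 2), h.joinCount_add (i, false) 0,
    h.joinCount_add (i, false) 1⟩

theorem drumJoin_outer (h : (drum s).Admissible (drumDecoration a b)) (i : Fin s) :
    drumJoin a b (i, true) 0 + drumJoin a b (i, true) 2 = a i ∧
    drumJoin a b (i, true) 0 + drumJoin a b (i, true) 1 = b i ∧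
    drumJoin a b (i, true) 1 + drumJoin a b (i, true) 2 = a (i - 1) :=
  ⟨(add_comm _ _).trans (h.joinCount_add (i, true) 2), h.joinCount_add (i, true) 0,
    h.joinCount_add (i, true) 1⟩

/-- Labellings of the edges of the drum: pairs of labels of arcs, and labels of radial edges. -/
def drumLabelEquiv (s : ℕ) (α : Type*) :
    (Fin s → α × α) × (Fin s → α) ≃ ((Fin s × Bool) ⊕ Fin s → α) where
  toFun x := Sum.elim (fun q => if q.2 then (x.1 q.1).2 else (x.1 q.1).1) x.2
  invFun m := (fun i => (m (Sum.inl (i, false)), m (Sum.inl (i, true))), fun i => m (Sum.inr i))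
  left_inv x := rfl
  right_inv m := by
    funext e
    rcases e with ⟨i, _ | _⟩ | i <;> rfl

/-- The inner vertex tensors of the drum. -/
noncomputable abbrev drumInner (a b : Fin s → ℕ) {N : ℕ} (i : Fin s) (y z r : Fin N) : ℝ :=
  innerKernel (a i) (a (i - 1)) (b i) (drumJoin a b (i, false) 0) (drumJoin a b (i, false) 1)
    (drumJoin a b (i, false) 2) y z r

/-- The outer vertex tensors of the drum. -/
noncomputable abbrev drumOuter (a b : Fin s → ℕ) {N : ℕ} (i : Fin s) (y z r : Fin N) : ℝ :=
  outerKernel (a i) (b i) (a (i - 1)) (drumJoin a b (i, true) 0) (drumJoin a b (i, true) 1)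
    (drumJoin a b (i, true) 2) y z r

/-- The state sum of the drum is a trace of transfer matrices. -/
theorem abs_penroseEval_drum (h : (drum s).Admissible (drumDecoration a b)) {N : ℕ}
    (ha : ∀ i, a i < N) (hb : ∀ i, b i < N) :
    |((drum s).penroseEval (drumDecoration a b) : ℝ)| =
      |∑ x : Fin s → Fin N × Fin N, ∏ i, ∑ r,
        drumInner a b i (x i).1 (x (i - 1)).1 r * drumOuter a b i (x i).2 (x (i - 1)).2 r| := by
  have h1 := congrArg (Int.cast : ℤ → ℝ) (CubicRibbonGraph.abs_penroseEval_eq_stateSum h)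
  push_cast at h1
  rw [h1]
  congr 1
  rw [sum_piFinset_range_eq (N := N) (drumDecoration a b)
    (by rintro (⟨i, ε⟩ | i); exacts [ha i, hb i])
    (fun m => ∏ v, (vertexTensor ((drum s).joinCount (drumDecoration a b) v)
      (fun i => CubicRibbonGraph.magneticNumber (drumDecoration a b) m
        ((drum s).ends.symm (v, i))) : ℝ)),
    ← Equiv.sum_comp (drumLabelEquiv s (Fin N)), Fintype.sum_prod_type]
  refine Finset.sum_congr rfl fun x _ => ?_
  rw [Finset.prod_univ_sum, Fintype.piFinset_univ]
  refine Finset.sum_congr rfl fun r _ => ?_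
  -- The squared norm on each arc is split evenly between the vertices at its two ends; a cyclic
  -- shift reassembles it.
  have hshift : ∏ i, stateNorm (a (i - 1)) (x (i - 1)).1 * stateNorm (a (i - 1)) (x (i - 1)).2 =
      ∏ i, stateNorm (a i) (x i).1 * stateNorm (a i) (x i).2 :=
    Equiv.prod_comp (Equiv.subRight (1 : Fin s))
      fun i => stateNorm (a i) (x i).1 * stateNorm (a i) (x i).2
  have hR : ∏ i, drumInner a b i (x i).1 (x (i - 1)).1 (r i) *
      drumOuter a b i (x i).2 (x (i - 1)).2 (r i) =
      (∏ i, stateNorm (a (i - 1)) (x (i - 1)).1 * stateNorm (a (i - 1)) (x (i - 1)).2) *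
      ∏ i, ((-1) ^ ((x i).1 : ℕ) * (-1) ^ ((x i).2 : ℕ) * (-1) ^ (r i : ℕ) *
        (stateNorm (a i) (x i).1 * stateNorm (a i) (x i).2) * stateNorm (b i) (r i) ^ 2 *
        (triTensor (drumJoin a b (i, false) 0) (drumJoin a b (i, false) 1)
          (drumJoin a b (i, false) 2) (x i).1 (a (i - 1) - (x (i - 1)).1) (r i) *
        triTensor (drumJoin a b (i, true) 0) (drumJoin a b (i, true) 1)
          (drumJoin a b (i, true) 2) (x i).2 (b i - r i) (a (i - 1) - (x (i - 1)).2) : ℝ)) := by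
    rw [← Finset.prod_mul_distrib]
    refine Finset.prod_congr rfl fun i _ => ?_
    rw [drumInner, drumOuter, innerKernel, outerKernel]
    ring
  rw [hR, hshift, ← Finset.prod_mul_distrib, Fintype.prod_sum_type, Fintype.prod_prod_type,
    Fintype.prod_prod_type, ← Finset.prod_mul_distrib, ← Finset.prod_mul_distrib]
  refine Finset.prod_congr rfl fun i _ => ?_
  rw [Fintype.prod_bool, Fintype.prod_bool, vertexTensor_eq_triTensor, vertexTensor_eq_triTensor]
  have e1 : ((-1 : ℝ) ^ ((drumLabelEquiv s (Fin N) (x, r) (Sum.inl (i, true)) : Fin N) : ℕ) *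
      stateNorm (drumDecoration a b (Sum.inl (i, true)))
        (drumLabelEquiv s (Fin N) (x, r) (Sum.inl (i, true))) ^ 2) =
      (-1) ^ ((x i).2 : ℕ) * stateNorm (a i) (x i).2 ^ 2 := rfl
  have e2 : ((-1 : ℝ) ^ ((drumLabelEquiv s (Fin N) (x, r) (Sum.inl (i, false)) : Fin N) : ℕ) *
      stateNorm (drumDecoration a b (Sum.inl (i, false)))
        (drumLabelEquiv s (Fin N) (x, r) (Sum.inl (i, false))) ^ 2) =
      (-1) ^ ((x i).1 : ℕ) * stateNorm (a i) (x i).1 ^ 2 := rfl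
  have e3 : ((-1 : ℝ) ^ ((drumLabelEquiv s (Fin N) (x, r) (Sum.inr i) : Fin N) : ℕ) *
      stateNorm (drumDecoration a b (Sum.inr i))
        (drumLabelEquiv s (Fin N) (x, r) (Sum.inr i)) ^ 2) =
      (-1) ^ (r i : ℕ) * stateNorm (b i) (r i) ^ 2 := rfl
  rw [e1, e2, e3]
  rw [show CubicRibbonGraph.magneticNumber (drumDecoration a b)
      (fun e => ((drumLabelEquiv s (Fin N) (x, r) e : Fin N) : ℕ))
      ((drum s).ends.symm ((i, false), 0)) = (x i).1 from rfl,
    show CubicRibbonGraph.magneticNumber (drumDecoration a b)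
      (fun e => ((drumLabelEquiv s (Fin N) (x, r) e : Fin N) : ℕ))
      ((drum s).ends.symm ((i, false), 1)) = a (i - 1) - (x (i - 1)).1 from rfl,
    show CubicRibbonGraph.magneticNumber (drumDecoration a b)
      (fun e => ((drumLabelEquiv s (Fin N) (x, r) e : Fin N) : ℕ))
      ((drum s).ends.symm ((i, false), 2)) = r i from rfl,
    show CubicRibbonGraph.magneticNumber (drumDecoration a b)
      (fun e => ((drumLabelEquiv s (Fin N) (x, r) e : Fin N) : ℕ))
      ((drum s).ends.symm ((i, true), 0)) = (x i).2 from rfl,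
    show CubicRibbonGraph.magneticNumber (drumDecoration a b)
      (fun e => ((drumLabelEquiv s (Fin N) (x, r) e : Fin N) : ℕ))
      ((drum s).ends.symm ((i, true), 1)) = b i - r i from rfl,
    show CubicRibbonGraph.magneticNumber (drumDecoration a b)
      (fun e => ((drumLabelEquiv s (Fin N) (x, r) e : Fin N) : ℕ))
      ((drum s).ends.symm ((i, true), 2)) = a (i - 1) - (x (i - 1)).2 from rfl]
  ring

theorem abs_penroseEval_drum_le (h : (drum s).Admissible (drumDecoration a b)) (j : Fin s) :
    |((drum s).penroseEval (drumDecoration a b) : ℝ)| ≤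
      ((a j : ℝ) + 1) ^ 2 * ∏ i,
        √((drum s).normAt (drumDecoration a b) (i, false) / (a i + 1) *
          ((drum s).normAt (drumDecoration a b) (i, true) / (a (i - 1) + 1))) := by
  obtain ⟨N, hN⟩ : ∃ N, ∀ i, a i < N ∧ b i < N := by
    refine ⟨∑ i, a i + ∑ i, b i + 1, fun i => ?_⟩
    have h1 := Finset.single_le_sum (f := a) (fun _ _ => Nat.zero_le _) (Finset.mem_univ i)
    have h2 := Finset.single_le_sum (f := b) (fun _ _ => Nat.zero_le _) (Finset.mem_univ i)
    omega
  rw [abs_penroseEval_drum h (fun i => (hN i).1) (fun i => (hN i).2)]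
  -- The columns of the transfer matrix at `j + 1` are supported on pairs of labels at most `a j`,
  -- which bounds its rank by `(a j + 1)²`.
  have hcard : (((Finset.Iic (⟨a j, (hN j).1⟩ : Fin N)) ×ˢ
      (Finset.Iic (⟨a j, (hN j).1⟩ : Fin N))).card : ℝ) = ((a j : ℝ) + 1) ^ 2 := by
    rw [Finset.card_product, Fin.card_Iic]
    push_cast
    ring
  rw [← hcard]
  refine abs_sum_cycle_le (fun i (y z : Fin N × Fin N) =>
    ∑ r, drumInner a b i y.1 z.1 r * drumOuter a b i y.2 z.2 r) _
    (fun i => Real.sqrt_nonneg _) (fun i => ?_) j _ (fun y z hz => ?_)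
  · obtain ⟨p0, p1, p2⟩ := drumJoin_inner h i
    obtain ⟨q0, q1, q2⟩ := drumJoin_outer h i
    exact formBound_transfer p0 p1 p2 q0 q1 q2 (hN i).1 (hN (i - 1)).1 (hN i).2
  · refine Finset.sum_eq_zero fun r _ => ?_
    rw [Finset.mem_product, Finset.mem_Iic, Finset.mem_Iic, not_and_or] at hz
    rcases hz with hz | hz
    · have : stateNorm (a (j + 1 - 1)) z.1 = 0 := by
        rw [add_sub_cancel_right, stateNorm]
        exact if_neg hz
      rw [drumInner, innerKernel, this]
      simp
    · have : stateNorm (a (j + 1 - 1)) z.2 = 0 := by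
        rw [add_sub_cancel_right, stateNorm]
        exact if_neg hz
      rw [drumOuter, outerKernel, this]
      simp

/-- The vertex norms cancel against the unitary normalization; each `√(a i + 1)` occurs twice around
the cycle, once from position `i` and once from position `i + 1`. -/
theorem abs_unitaryEval_drum_le (h : (drum s).Admissible (drumDecoration a b)) (j : Fin s) :
    |(drum s).unitaryEval (drumDecoration a b)| ≤ ((a j : ℝ) + 1) ^ 2 / ∏ i, ((a i : ℝ) + 1) := by
  have hpos : ∀ i, (0 : ℝ) < (a i : ℝ) + 1 := fun i => by positivity
  have h1 : ∏ i, √((drum s).normAt (drumDecoration a b) (i, false) / (a i + 1) *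
      ((drum s).normAt (drumDecoration a b) (i, true) / (a (i - 1) + 1))) =
      (∏ v, √((drum s).normAt (drumDecoration a b) v)) / ∏ i, ((a i : ℝ) + 1) := by
    have h0 : ∏ i, √((a (i - 1) : ℝ) + 1) = ∏ i, √((a i : ℝ) + 1) :=
      Equiv.prod_comp (Equiv.subRight (1 : Fin s)) fun i => √((a i : ℝ) + 1)
    have h2 : ∏ i, √((a i : ℝ) + 1) * √((a (i - 1) : ℝ) + 1) = ∏ i, ((a i : ℝ) + 1) := by
      rw [Finset.prod_mul_distrib, h0, ← Finset.prod_mul_distrib]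
      exact Finset.prod_congr rfl fun i _ => Real.mul_self_sqrt (hpos i).le
    rw [Fintype.prod_prod_type, ← h2, ← Finset.prod_div_distrib]
    refine Finset.prod_congr rfl fun i _ => ?_
    rw [Fintype.prod_bool, Real.sqrt_mul (div_nonneg ((drum s).normAt_pos _ _).le (hpos i).le),
      Real.sqrt_div ((drum s).normAt_pos _ _).le, Real.sqrt_div ((drum s).normAt_pos _ _).le,
      div_mul_div_comm, mul_comm (√((drum s).normAt _ (i, false)))]
  have h3 := abs_penroseEval_drum_le h j
  have h4 : 0 < ∏ v, √((drum s).normAt (drumDecoration a b) v) :=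
    Finset.prod_pos fun v _ => Real.sqrt_pos.mpr ((drum s).normAt_pos _ v)
  rw [h1] at h3
  rw [CubicRibbonGraph.unitaryEval_eq h, abs_mul, Finset.prod_inv_distrib,
    abs_of_pos (inv_pos.mpr h4), ← div_eq_mul_inv, div_le_iff₀ h4]
  refine h3.trans (le_of_eq ?_)
  ring

end Drum

theorem mainTheorem8 (s : ℕ) [NeZero s] (a b : Fin s → ℕ)
    (hγ : (drum s).Admissible (drumDecoration a b)) :
    |(drum s).unitaryEval (drumDecoration a b)| ≤
        (((Finset.univ.inf' Finset.univ_nonempty a : ℕ) : ℝ) + 1) ^ 2 / ∏ i, ((a i : ℝ) + 1) ∧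
      (2 ≤ s → |(drum s).unitaryEval (drumDecoration a b)| ≤ 1) := by
  obtain ⟨j, _, hj⟩ := Finset.exists_mem_eq_inf' (Finset.univ_nonempty (α := Fin s)) a
  have h1 := abs_unitaryEval_drum_le hγ j
  refine ⟨by rw [hj]; exact h1, fun hs => h1.trans ?_⟩
  have hmin : ∀ i, a j ≤ a i := fun i => hj ▸ Finset.inf'_le a (Finset.mem_univ i)
  rw [div_le_one (Finset.prod_pos fun i _ => by positivity)]
  calc ((a j : ℝ) + 1) ^ 2 ≤ ((a j : ℝ) + 1) ^ s :=
        pow_le_pow_right₀ (by linarith [Nat.cast_nonneg (α := ℝ) (a j)]) hs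
    _ = ∏ _i : Fin s, ((a j : ℝ) + 1) := by simp
    _ ≤ ∏ i, ((a i : ℝ) + 1) := by
        refine Finset.prod_le_prod (fun _ _ => by positivity) fun i _ => ?_
        have : (a j : ℝ) ≤ a i := by exact_mod_cast hmin i
        linarith
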